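/- Fix an embedding of $\overline{\mathbb Q}$ into $\mathbb C$. Consider the following conditions on a power series $\sum_{n\ge 0} a_n z^n$ with $a_n\in\overline{\mathbb Q}$: (i) it is a solution of a non-zero linear differential equation with coefficients in $\overline{\mathbb Q}(z)$; (ii) there exists $C>0$ such that $|\sigma(a_n)|\le C^{n+1}$ for all $n\ge 0$ and all $\sigma\in\mathrm{Gal}(\overline{\mathbb Q}/\mathbb Q)$, and such that there is a sequence of positive integers $d_n\le C^{n+1}$ for which $d_n a_m$ is an algebraic integer for all $m\le n$. The power series is called a $G$-function if it satisfies (i) and (ii). Fix a determination of $\log(z)$ on a domain $\Omega\subset\mathbb C\setminus\{0\}$ with $0\in\overline{\Omega}$ (for instance a cut plane), put $z^\alpha=\exp(\alpha\log z)$, and consider functions $f$ on $\Omega$ near $0$. Such an $f$ is a Nilsson–Gevrey arithmetic series of order $0$ if, for $z\in\Omega$ close enough to $0$, $$f(z)=\sum_{(\alpha,j,k)\in \mathbb S} \lambda_{\alpha,j,k}\, z^{\alpha} \log(z)^j f_{\alpha,j,k}(z),\qquad (*)$$ where $\mathbb S$ is a finite subset of $\mathbb Q\times\mathbb N\times\mathbb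 N$, $\lambda_{\alpha,j,k}\in\mathbb C$, and each $f_{\alpha,j,k}$ is a power series with coefficients in $\overline{\mathbb Q}$ satisfying (ii). It is holonomic if on $\Omega$ near $0$ it is an analytic solution of a non-zero linear differential equation with coefficients in $\mathbb C(z)$. Then the holonomic Nilsson–Gevrey arithmetic series of order $0$ are exactly the functions that can be written in the form $(*)$, with $\mathbb S$ a finite subset of $\mathbb Q\times\mathbb N\times\mathbb N$, $\lambda_{\alpha,j,k}\in\mathbb C$, and each $f_{\alpha,j,k}$ a $G$-function. -/

import Mathlib

open Filter Topology

noncomputable section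

namespace Nilsson

/-- A formal power series over a field `K` is holonomic over `K(z)` when it is a solution of a
nonzero linear differential equation with coefficients in `K(z)`; multiplying by a common
denominator, the coefficients are taken in `K[z]`. -/
def IsHolonomicSeries {K : Type*} [Field K] (F : PowerSeries K) : Prop :=
  ∃ (N : ℕ) (p : ℕ → Polynomial K), (∃ i ≤ N, p i ≠ 0) ∧
    ∑ i ∈ Finset.range (N + 1), (p i : PowerSeries K) * (PowerSeries.derivative K)^[i] F = 0

/-- The two arithmetic growth conditions on a power series `∑ aₙ zⁿ` with algebraic coefficients,
relative to a fixed embedding `ι` of the field of algebraic numbers into `ℂ`: for some `C > 0`, all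
conjugates of `aₙ` have modulus at most `C ^ (n + 1)`, and there are positive integers
`dₙ ≤ C ^ (n + 1)` such that `dₙ aₘ` is an algebraic integer for all `m ≤ n`. -/
def IsArithmeticGevrey (ι : AlgebraicClosure ℚ →+* ℂ)
    (F : PowerSeries (AlgebraicClosure ℚ)) : Prop :=
  ∃ C : ℝ, 0 < C ∧
    (∀ (σ : AlgebraicClosure ℚ ≃ₐ[ℚ] AlgebraicClosure ℚ) (n : ℕ),
      ‖ι (σ (PowerSeries.coeff n F))‖ ≤ C ^ (n + 1)) ∧
    ∃ d : ℕ → ℕ, ∀ n : ℕ, 0 < d n ∧ (d n : ℝ) ≤ C ^ (n + 1) ∧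
      ∀ m ≤ n, IsIntegral ℤ ((d n : AlgebraicClosure ℚ) * PowerSeries.coeff m F)

/-- A `G`-function: a power series with algebraic coefficients which is a solution of a nonzero
linear differential equation over the rational functions with algebraic coefficients, and which
satisfies the two arithmetic growth conditions. -/
def IsGFunction (ι : AlgebraicClosure ℚ →+* ℂ) (F : PowerSeries (AlgebraicClosure ℚ)) : Prop :=
  IsHolonomicSeries F ∧ IsArithmeticGevrey ι F

/-- The sum of a power series with algebraic coefficients at a complex number `z`. Under
`IsArithmeticGevrey` the series converges absolutely as soon as `‖z‖ < 1 / C`. -/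
def seriesSum (ι : AlgebraicClosure ℚ →+* ℂ) (F : PowerSeries (AlgebraicClosure ℚ)) (z : ℂ) : ℂ :=
  ∑' n : ℕ, ι (PowerSeries.coeff n F) * z ^ n

/-- `ℓ` is a determination of the logarithm on the domain `Ω`, which accumulates at the origin
(for instance, `Ω` is the complex plane cut along a half-line starting at `0`). -/
structure IsLogDetermination (Ω : Set ℂ) (ℓ : ℂ → ℂ) : Prop where
  isOpen : IsOpen Ω
  isConnected : IsConnected Ω
  zero_mem_closure : (0 : ℂ) ∈ closure Ω
  continuousOn : ContinuousOn ℓ Ω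
  exp_eq : ∀ z ∈ Ω, Complex.exp (ℓ z) = z

/-- The finite sum `∑ c_{α,j,k} z^α log(z)^j f_{α,j,k}(z)` over `(α, j, k) ∈ S`, where `log = ℓ` is
the chosen determination of the logarithm and `z^α = exp (α log z)`. -/
def nilssonSum (ι : AlgebraicClosure ℚ →+* ℂ) (ℓ : ℂ → ℂ) (S : Finset (ℚ × ℕ × ℕ))
    (c : ℚ × ℕ × ℕ → ℂ) (F : ℚ × ℕ × ℕ → PowerSeries (AlgebraicClosure ℚ)) (z : ℂ) : ℂ :=
  ∑ s ∈ S, c s * Complex.exp ((s.1 : ℂ) * ℓ z) * ℓ z ^ s.2.1 * seriesSum ι (F s) z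

/-- `f` is, on `Ω` and near the origin, a Nilsson–Gevrey arithmetic series of order `0`. -/
def IsNGA (ι : AlgebraicClosure ℚ →+* ℂ) (Ω : Set ℂ) (ℓ : ℂ → ℂ) (f : ℂ → ℂ) : Prop :=
  ∃ (S : Finset (ℚ × ℕ × ℕ)) (c : ℚ × ℕ × ℕ → ℂ)
    (F : ℚ × ℕ × ℕ → PowerSeries (AlgebraicClosure ℚ)),
    (∀ s ∈ S, IsArithmeticGevrey ι (F s)) ∧ ∀ᶠ z in 𝓝[Ω] 0, f z = nilssonSum ι ℓ S c F z

/-- `f` is, on `Ω` and near the origin, holonomic: it is an analytic solution of a nonzero linear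
differential equation with coefficients in `ℂ(z)`; multiplying by a common denominator, the
coefficients are taken in `ℂ[z]`. -/
def IsHolonomic (Ω : Set ℂ) (f : ℂ → ℂ) : Prop :=
  ∃ r > 0, AnalyticOnNhd ℂ f (Ω ∩ Metric.ball 0 r) ∧
    ∃ (N : ℕ) (p : ℕ → Polynomial ℂ), (∃ i ≤ N, p i ≠ 0) ∧
      ∀ z ∈ Ω ∩ Metric.ball 0 r,
        ∑ i ∈ Finset.range (N + 1), (p i).eval z * iteratedDeriv i f z = 0

end Nilsson

end

/-!
The proof reduces the analytic statement to formal linear differential systems over `ℂ[z]`.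

*Finiteness.* An element of a `K[X]`-module with an operator `D` satisfying the Leibniz rule for
`X d/dX` is differentially finite (`IsDFinite`) when it lies in a finitely generated submodule that
`D` preserves up to a denominator. This is visibly stable under sums, and it is equivalent to the
existence of a nonzero linear differential equation: one direction is linear dependence of too many
vectors (`IsDFinite.exists_equation`), the other takes the span of the successive derivatives
(`IsDFinite.of_equation`). Equations are written with the operators `D (D - 1) ⋯ (D - i + 1)`, which
are `zⁱ (d/dz)ⁱ` for `D = z d/dz`. Formal sums `∑ z^α log(z)^j G_{α,j}(z)` with power series
`G_{α,j}` form such a module (`nilssonOp`). A term `z^α log(z)^j g` with `g` holonomic is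
differentially finite (`isDFinite_single`); conversely, if the whole sum is so, then so is each
`G_{α,j}`, because the coefficients of the highest power of the logarithm satisfy the equation by
themselves and can be removed (`IsDFinite.nilsson_coeff`).

*From functions to formal sums.* With `z = exp w` and `w = log z`, a sum of convergent series becomes
an analytic function on a half-plane `re w < log r`, and `z d/dz` becomes `d/dw`. If it vanishes at
the values of the logarithm on `Ω`, it vanishes on the half-plane by analytic continuation, and the
behaviour as `w → -∞` shows that all coefficients vanish, provided that the exponents `α` are
distinct modulo `ℤ` (`eq_zero_of_nilssonEval_eq_zero`). So the equation of `f` holds formally, and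
the coefficients `G_{α,j} = ∑ λₖ fₖ` are holonomic over `ℂ(z)`.

*Descent.* It remains to write a holonomic `∑ λₖ fₖ`, with `fₖ` over `K = ℚbar` and `λₖ` complex, as a
combination of holonomic series over `K` (`exists_holonomic_decomposition`). The vectors `v ∈ Kⁿ` for
which `∑ vₖ fₖ` is holonomic form a subspace `V`. Let `A` be the `K`-algebra generated by the `λₖ` and
the coefficients of the equation. Every homomorphism `A → K` that does not kill a chosen coefficient
of the equation sends `(λₖ)` into `V`. By the Nullstellensatz these homomorphisms detect the nonzero
elements of `A`, so `(λₖ)` lies in `V ⊗ ℂ`: for a projection `P` of `Kⁿ` onto `V` one has `P λ = λ`, and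
then `∑ λₖ fₖ = ∑ λₗ hₗ` with `hₗ = ∑ Pₖₗ fₖ` holonomic. The arithmetic growth conditions pass to the
`hₗ`, which are therefore `G`-functions.
-/

/-! ### Differentially finite elements -/

open Polynomial in
/-- The Leibniz rule for an additive operator `D` on a `K[X]`-module with respect to the Euler
derivation `X d/dX` of `K[X]`: the module together with `D` is a linear differential system. -/
def IsEulerOperator (K : Type*) {M : Type*} [Field K] [AddCommGroup M] [Module K[X] M]
    (D : M →+ M) : Prop :=
  ∀ (p : K[X]) (m : M), D (p • m) = (X * derivative p) • m + p • D m

open Polynomial in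
/-- An element `x` is differentially finite for `D` when it lies in a finitely generated
`K[X]`-submodule which `D` maps into itself up to a common denominator `q`. This is the
denominator-free form of "the derivatives of `x` span a finite-dimensional `K(X)`-space". -/
def IsDFinite (K : Type*) {M : Type*} [Field K] [AddCommGroup M] [Module K[X] M] (D : M →+ M)
    (x : M) : Prop :=
  ∃ W : Submodule K[X] M, W.FG ∧ x ∈ W ∧ ∃ q : K[X], q ≠ 0 ∧ ∀ w ∈ W, q • D w ∈ W

/-- The falling factorial `D (D - 1) ⋯ (D - i + 1)`, which is `Xⁱ (d/dX)ⁱ` when `D = X d/dX`. -/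
def fallingOp {M : Type*} [AddCommGroup M] (D : M →+ M) : ℕ → M → M
  | 0, x => x
  | i + 1, x => D (fallingOp D i x) - i • fallingOp D i x

namespace IsDFinite

open Polynomial

variable {K M M' : Type*} [Field K] [AddCommGroup M] [Module K[X] M] [AddCommGroup M']
  [Module K[X] M'] {D : M →+ M} {D' : M' →+ M'}

theorem zero : IsDFinite K D (0 : M) :=
  ⟨⊥, Submodule.fg_bot, by simp, 1, one_ne_zero, by simp⟩

theorem add {x y : M} (hx : IsDFinite K D x) (hy : IsDFinite K D y) : IsDFinite K D (x + y) := by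
  obtain ⟨V, hV, hxV, p, hp, hpV⟩ := hx
  obtain ⟨W, hW, hyW, q, hq, hqW⟩ := hy
  refine ⟨V ⊔ W, hV.sup hW, Submodule.add_mem_sup hxV hyW, p * q, mul_ne_zero hp hq, ?_⟩
  intro w hw
  obtain ⟨a, ha, b, hb, rfl⟩ := Submodule.mem_sup.1 hw
  rw [map_add, smul_add]
  refine Submodule.add_mem_sup ?_ ?_
  · rw [mul_comm, mul_smul]
    exact V.smul_mem _ (hpV a ha)
  · rw [mul_smul]
    exact W.smul_mem _ (hqW b hb)

theorem smul (p : K[X]) {x : M} (hx : IsDFinite K D x) : IsDFinite K D (p • x) := by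
  obtain ⟨V, hV, hxV, q, hq, hqV⟩ := hx
  exact ⟨V, hV, V.smul_mem _ hxV, q, hq, hqV⟩

theorem sub {x y : M} (hx : IsDFinite K D x) (hy : IsDFinite K D y) : IsDFinite K D (x - y) := by
  have h := hx.add (hy.smul (-1))
  rwa [neg_smul, one_smul, ← sub_eq_add_neg] at h

theorem sum {ι : Type*} (s : Finset ι) {x : ι → M} (h : ∀ i ∈ s, IsDFinite K D (x i)) :
    IsDFinite K D (∑ i ∈ s, x i) := by
  classical
  induction s using Finset.induction_on with
  | empty => simpa using zero
  | insert a s ha ih =>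
    rw [Finset.sum_insert ha]
    exact (h a (Finset.mem_insert_self a s)).add
      (ih fun i hi => h i (Finset.mem_insert_of_mem hi))

/-- Coordinates: a linear map on a `D`-stable submodule that intertwines `D` with `D'` up to a
scalar preserves differential finiteness. -/
theorem map_of_stable {x : M} (hx : IsDFinite K D x) (N : Submodule K[X] M) (hN : ∀ n ∈ N, D n ∈ N)
    (hxN : x ∈ N) (φ : M →ₗ[K[X]] M') (a : K[X])
    (hφ : ∀ n ∈ N, φ (D n) = D' (φ n) + a • φ n) : IsDFinite K D' (φ x) := by
  obtain ⟨W, hW, hxW, q, hq, hqW⟩ := hx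
  refine ⟨(W ⊓ N).map φ, (hW.of_le inf_le_left).map φ,
    Submodule.mem_map_of_mem ⟨hxW, hxN⟩, q, hq, ?_⟩
  rintro _ ⟨w, ⟨hw, hwN⟩, rfl⟩
  rw [← add_sub_cancel_right (D' (φ w)) (a • φ w), ← hφ w hwN, smul_sub, ← map_smul]
  exact Submodule.sub_mem _ (Submodule.mem_map_of_mem ⟨hqW w hw, N.smul_mem _ (hN w hwN)⟩)
    (Submodule.smul_mem _ _ (Submodule.smul_mem _ _ (Submodule.mem_map_of_mem ⟨hw, hwN⟩)))

theorem fallingOp_mem (hD : IsEulerOperator K D) {W : Submodule K[X] M} {q : K[X]}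
    (hqW : ∀ w ∈ W, q • D w ∈ W) {x : M} (hx : x ∈ W) (i : ℕ) :
    q ^ i • fallingOp D i x ∈ W := by
  induction i with
  | zero => simpa [fallingOp] using hx
  | succ i ih =>
    have h1 := hqW _ ih
    rw [hD, smul_add] at h1
    -- `q • q ^ i • D y` is recovered from `q • D (q ^ i • y)` by the Leibniz rule
    have h2 : q • (X * derivative (q ^ i)) • fallingOp D i x ∈ W := by
      rcases i with _ | i
      · simp
      · have : q • (X * derivative (q ^ (i + 1))) • fallingOp D (i + 1) x
            = (X * C ((i : K) + 1) * derivative q) • (q ^ (i + 1) • fallingOp D (i + 1) x) := by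
          rw [smul_smul, smul_smul, derivative_pow_succ]
          congr 1
          ring
        rw [this]
        exact W.smul_mem _ ih
    have h3 : q ^ (i + 1) • fallingOp D (i + 1) x
        = (q • (X * derivative (q ^ i)) • fallingOp D i x + q • q ^ i • D (fallingOp D i x))
          - q • (X * derivative (q ^ i)) • fallingOp D i x
          - q • i • (q ^ i • fallingOp D i x) := by
      rw [fallingOp, smul_sub, add_sub_cancel_left, smul_smul, ← pow_succ', smul_comm i, smul_smul q,
        ← pow_succ']
    rw [h3]
    exact W.sub_mem (W.sub_mem h1 h2) (W.smul_mem _ (nsmul_mem ih i))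

/-- More vectors `qⁱ • D (D - 1) ⋯ (D - i + 1) x` than generators of `W` are linearly dependent. -/
theorem exists_equation (hD : IsEulerOperator K D) {x : M} (hx : IsDFinite K D x) :
    ∃ (N : ℕ) (p : ℕ → K[X]), (∃ i ≤ N, p i ≠ 0) ∧
      ∑ i ∈ Finset.range (N + 1), p i • fallingOp D i x = 0 := by
  classical
  obtain ⟨W, hW, hxW, q, hq, hqW⟩ := hx
  have : Module.Finite K[X] W := Module.Finite.iff_fg.2 hW
  let N := Module.finrank K[X] W
  let v : Fin (N + 1) → W := fun i => ⟨q ^ (i : ℕ) • fallingOp D i x, fallingOp_mem hD hqW hxW i⟩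
  have hv : ¬ LinearIndependent K[X] v := fun h => by
    have := h.fintype_card_le_finrank
    simp [N] at this
  obtain ⟨g, hg, i, hi⟩ := Fintype.not_linearIndependent_iff.1 hv
  let p : ℕ → K[X] := fun i => if h : i < N + 1 then g ⟨i, h⟩ * q ^ i else 0
  refine ⟨N, p, ⟨i, Nat.lt_succ_iff.1 i.2, ?_⟩, ?_⟩
  · have : p i = g i * q ^ (i : ℕ) := by simp only [p, i.2, dite_true]
    rw [this]
    exact mul_ne_zero hi (pow_ne_zero _ hq)
  · have h := congrArg Subtype.val hg
    rw [Finset.sum_range]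
    rw [AddSubmonoidClass.coe_finsetSum] at h
    refine Eq.trans (Finset.sum_congr rfl fun j _ => ?_) h
    have : p j = g j * q ^ (j : ℕ) := by simp only [p, j.2, dite_true]
    rw [this, mul_smul]
    rfl

theorem of_equation (hD : IsEulerOperator K D) {x : M} {N : ℕ} {p : ℕ → K[X]}
    (hp : ∃ i ≤ N, p i ≠ 0) (h : ∑ i ∈ Finset.range (N + 1), p i • fallingOp D i x = 0) :
    IsDFinite K D x := by
  classical
  -- lower the order until the leading coefficient is nonzero
  induction N with
  | zero =>
    obtain ⟨i, hi, hpi⟩ := hp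
    obtain rfl : i = 0 := by omega
    have h0 : p 0 • x = 0 := by simpa [fallingOp] using h
    refine ⟨Submodule.span K[X] {x}, Submodule.fg_span_singleton x,
      Submodule.mem_span_singleton_self x, p 0, hpi, fun w hw => ?_⟩
    obtain ⟨a, rfl⟩ := Submodule.mem_span_singleton.1 hw
    have h1 := congrArg D h0
    rw [hD, map_zero] at h1
    have h2 : p 0 • D (a • x)
        = (p 0 * (X * derivative a) - a * (X * derivative (p 0))) • x := by
      rw [hD, sub_smul, mul_smul a, eq_neg_of_add_eq_zero_left h1]
      simp only [smul_add, smul_neg, smul_smul, mul_comm a]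
      abel
    rw [h2]
    exact Submodule.smul_mem _ _ (Submodule.mem_span_singleton_self x)
  | succ N ih =>
    by_cases hN : p (N + 1) = 0
    · obtain ⟨i, hi, hpi⟩ := hp
      refine ih ⟨i, ?_, hpi⟩ ?_
      · rcases Nat.lt_or_ge N i with h' | h'
        · obtain rfl : i = N + 1 := by omega
          exact absurd hN hpi
        · exact h'
      · rwa [Finset.sum_range_succ, hN, zero_smul, add_zero] at h
    · let T := fun i => fallingOp D i x
      let W := Submodule.span K[X] (T '' Finset.range (N + 2))
      have hT : ∀ i < N + 2, T i ∈ W := fun i hi =>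
        Submodule.subset_span ⟨i, by simpa using hi, rfl⟩
      have hDT : ∀ i, D (T i) = T (i + 1) + i • T i := fun i => by
        simp [T, fallingOp]
      have hsum : D (∑ i ∈ Finset.range (N + 2), p i • T i) = 0 := by
        simp only [T]
        rw [h, map_zero]
      have htop : p (N + 1) • D (T (N + 1)) ∈ W := by
        rw [Finset.sum_range_succ, map_add, hD] at hsum
        have h1 : D (∑ i ∈ Finset.range (N + 1), p i • T i) ∈ W := by
          rw [map_sum]
          refine W.sum_mem fun i hi => ?_
          have hi' := Finset.mem_range.1 hi
          rw [hD, hDT]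
          exact W.add_mem (W.smul_mem _ (hT i (by omega)))
            (W.smul_mem _ (W.add_mem (hT _ (by omega)) (nsmul_mem (hT i (by omega)) i)))
        have h2 : p (N + 1) • D (T (N + 1)) = -(D (∑ i ∈ Finset.range (N + 1), p i • T i)
            + (X * derivative (p (N + 1))) • T (N + 1)) := by
          rw [eq_neg_iff_add_eq_zero, ← hsum]
          abel
        rw [h2]
        exact W.neg_mem (W.add_mem h1 (W.smul_mem _ (hT _ (by omega))))
      refine ⟨W, Submodule.fg_span (Set.Finite.image _ (Finset.finite_toSet _)),
        hT 0 (by omega), p (N + 1), hN, fun w hw => ?_⟩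
      induction hw using Submodule.span_induction with
      | mem y hy =>
        obtain ⟨i, hi, rfl⟩ := hy
        have hi' : i < N + 2 := by simpa using hi
        rcases Nat.lt_or_ge i (N + 1) with h' | h'
        · rw [hDT]
          exact W.smul_mem _ (W.add_mem (hT _ (by omega)) (nsmul_mem (hT i hi') i))
        · obtain rfl : i = N + 1 := by omega
          exact htop
      | zero => simp
      | add a b _ _ ha hb =>
        rw [map_add, smul_add]
        exact W.add_mem ha hb
      | smul a y hy hay =>
        rw [hD, smul_add, smul_comm (p (N + 1)) a]
        exact W.add_mem (W.smul_mem _ (W.smul_mem _ hy)) (W.smul_mem _ hay)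

end IsDFinite

/-! ### Holonomic power series and formal sums with logarithms -/

/-- The Euler derivation `X d/dX` of formal power series. -/
noncomputable def eulerOp (K : Type*) [Field K] : PowerSeries K →+ PowerSeries K :=
  (AddMonoidHom.mulLeft PowerSeries.X).comp (PowerSeries.derivative K : _ →ₗ[K] _).toAddMonoidHom

section Series

open Polynomial

variable {K : Type*} [Field K]

theorem eulerOp_apply (F : PowerSeries K) :
    eulerOp K F = PowerSeries.X * PowerSeries.derivative K F := rfl

theorem polynomial_smul_eq (p : K[X]) (F : PowerSeries K) : p • F = (p : PowerSeries K) * F := by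
  rw [Algebra.smul_def, PowerSeries.algebraMap_apply']
  simp

theorem C_smul_eq (a : K) (F : PowerSeries K) : (C a : K[X]) • F = a • F := by
  rw [polynomial_smul_eq, Polynomial.coe_C, PowerSeries.smul_eq_C_mul]

theorem isEulerOperator_eulerOp : IsEulerOperator K (eulerOp K) := by
  intro p F
  simp only [polynomial_smul_eq, eulerOp_apply, Derivation.leibniz, PowerSeries.derivative_coe,
    smul_eq_mul, Polynomial.coe_mul, Polynomial.coe_X]
  ring

theorem fallingOp_eulerOp (F : PowerSeries K) (i : ℕ) :
    fallingOp (eulerOp K) i F = PowerSeries.X ^ i * (PowerSeries.derivative K)^[i] F := by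
  induction i with
  | zero => simp [fallingOp]
  | succ i ih =>
    rw [fallingOp, ih, eulerOp_apply, Function.iterate_succ_apply', Derivation.leibniz,
      Derivation.leibniz_pow]
    rcases i with _ | i
    · simp
    · simp only [smul_eq_mul, PowerSeries.derivative_X, nsmul_eq_mul, Nat.add_sub_cancel]
      ring

theorem isHolonomicSeries_iff {F : PowerSeries K} :
    Nilsson.IsHolonomicSeries F ↔ IsDFinite K (eulerOp K) F := by
  constructor
  · rintro ⟨N, p, ⟨i, hi, hpi⟩, h⟩
    -- multiply the equation by `X ^ N`
    refine IsDFinite.of_equation (N := N) (p := fun i => p i * X ^ (N - i))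
      isEulerOperator_eulerOp ⟨i, hi, mul_ne_zero hpi (pow_ne_zero _ X_ne_zero)⟩ ?_
    rw [← mul_zero ((PowerSeries.X : PowerSeries K) ^ N), ← h, Finset.mul_sum]
    refine Finset.sum_congr rfl fun j hj => ?_
    have hj' : j ≤ N := Nat.lt_succ_iff.1 (Finset.mem_range.1 hj)
    rw [fallingOp_eulerOp, polynomial_smul_eq, Polynomial.coe_mul, Polynomial.coe_pow,
      Polynomial.coe_X, ← Nat.sub_add_cancel hj', pow_add, Nat.sub_add_cancel hj']
    ring
  · intro h
    obtain ⟨N, p, ⟨i, hi, hpi⟩, h⟩ := h.exists_equation isEulerOperator_eulerOp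
    refine ⟨N, fun i => p i * X ^ i, ⟨i, hi, mul_ne_zero hpi (pow_ne_zero _ X_ne_zero)⟩, ?_⟩
    rw [← h]
    refine Finset.sum_congr rfl fun j _ => ?_
    rw [fallingOp_eulerOp, polynomial_smul_eq, Polynomial.coe_mul, Polynomial.coe_pow,
      Polynomial.coe_X, mul_assoc]

theorem derivative_iterate_map {A B : Type*} [CommSemiring A] [CommSemiring B] (φ : A →+* B)
    (F : PowerSeries A) (i : ℕ) :
    (PowerSeries.derivative B)^[i] (PowerSeries.map φ F)
      = PowerSeries.map φ ((PowerSeries.derivative A)^[i] F) := by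
  ext n
  simp [PowerSeries.coeff_iterate_derivative]

theorem map_polynomial_coe {A B : Type*} [CommSemiring A] [CommSemiring B] (φ : A →+* B)
    (p : A[X]) :
    PowerSeries.map φ (p : PowerSeries A) = ((p.map φ : B[X]) : PowerSeries B) := by
  ext n
  simp

theorem isHolonomicSeries_map {L : Type*} [Field L] (φ : K →+* L) {F : PowerSeries K}
    (h : Nilsson.IsHolonomicSeries F) : Nilsson.IsHolonomicSeries (PowerSeries.map φ F) := by
  obtain ⟨N, p, ⟨i, hi, hpi⟩, h⟩ := h
  refine ⟨N, fun i => (p i).map φ, ⟨i, hi, (Polynomial.map_ne_zero_iff φ.injective).2 hpi⟩, ?_⟩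
  rw [← map_zero (PowerSeries.map φ), ← h, map_sum]
  refine Finset.sum_congr rfl fun j _ => ?_
  rw [map_mul, derivative_iterate_map, map_polynomial_coe]

/-- The power series over `K` that are holonomic, as a `K`-subspace. -/
def holonomicSubmodule (K : Type*) [Field K] : Submodule K (PowerSeries K) where
  carrier := {F | Nilsson.IsHolonomicSeries F}
  zero_mem' := isHolonomicSeries_iff.2 IsDFinite.zero
  add_mem' ha hb :=
    isHolonomicSeries_iff.2 ((isHolonomicSeries_iff.1 ha).add (isHolonomicSeries_iff.1 hb))
  smul_mem' c F hF := by
    rw [← C_smul_eq]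
    exact isHolonomicSeries_iff.2 ((isHolonomicSeries_iff.1 hF).smul (C c))

/-- A family of power series `G (α, j)`, `α ∈ ℚ`, `j ∈ ℕ`, stands for the formal sum
`∑ z^α log(z)^j G (α, j)`. This is the operator `z d/dz` on such sums. -/
noncomputable def nilssonOp : (ℚ × ℕ → PowerSeries ℂ) →+ (ℚ × ℕ → PowerSeries ℂ) where
  toFun G s := eulerOp ℂ (G s) + (C (s.1 : ℂ) : ℂ[X]) • G s + (s.2 + 1) • G (s.1, s.2 + 1)
  map_zero' := by
    ext1 s
    simp
  map_add' G H := by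
    ext1 s
    simp only [Pi.add_apply, map_add, smul_add]
    abel

theorem nilssonOp_apply (G : ℚ × ℕ → PowerSeries ℂ) (s : ℚ × ℕ) :
    nilssonOp G s
      = eulerOp ℂ (G s) + (C (s.1 : ℂ) : ℂ[X]) • G s + (s.2 + 1) • G (s.1, s.2 + 1) := rfl

theorem isEulerOperator_nilssonOp : IsEulerOperator ℂ nilssonOp := by
  intro p G
  ext1 s
  simp only [nilssonOp_apply, Pi.smul_apply, Pi.add_apply, isEulerOperator_eulerOp p (G s),
    smul_add, smul_comm p]
  abel

/-- The formal sums in which only powers of the logarithm less than `J` occur. -/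
def logDegreeLT (J : ℕ) : Submodule ℂ[X] (ℚ × ℕ → PowerSeries ℂ) where
  carrier := {G | ∀ s, J ≤ s.2 → G s = 0}
  zero_mem' _ _ := rfl
  add_mem' hG hH s hs := by simp [hG s hs, hH s hs]
  smul_mem' p G hG s hs := by simp [hG s hs]

theorem nilssonOp_mem_logDegreeLT {J : ℕ} {G : ℚ × ℕ → PowerSeries ℂ} (hG : G ∈ logDegreeLT J) :
    nilssonOp G ∈ logDegreeLT J := by
  intro s hs
  rw [nilssonOp_apply, hG s hs, hG (s.1, s.2 + 1) (by simp; omega)]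
  simp

theorem isDFinite_single (s : ℚ × ℕ) {F : PowerSeries ℂ} (hF : IsDFinite ℂ (eulerOp ℂ) F) :
    IsDFinite ℂ nilssonOp (Pi.single s F) := by
  obtain ⟨V, hV, hFV, q, hq, hqV⟩ := hF
  obtain ⟨α, j⟩ := s
  let e : ℕ → PowerSeries ℂ →ₗ[ℂ[X]] (ℚ × ℕ → PowerSeries ℂ) := fun j =>
    LinearMap.single ℂ[X] (fun _ => PowerSeries ℂ) (α, j)
  have he0 : ∀ v, nilssonOp (e 0 v) = e 0 (eulerOp ℂ v + (C (α : ℂ) : ℂ[X]) • v) := by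
    intro v
    ext1 ⟨β, i⟩
    by_cases h : (β, i) = (α, 0)
    · cases h
      simp [nilssonOp_apply, e]
    · simp [nilssonOp_apply, e, h]
  have heS : ∀ j v, nilssonOp (e (j + 1) v)
      = e (j + 1) (eulerOp ℂ v + (C (α : ℂ) : ℂ[X]) • v) + (j + 1) • e j v := by
    intro j v
    ext1 ⟨β, i⟩
    by_cases h : (β, i) = (α, j + 1)
    · cases h
      simp [nilssonOp_apply, e]
    · by_cases h' : (β, i) = (α, j)
      · cases h'
        simp [nilssonOp_apply, e]
      · have h'' : ¬ (β = α ∧ i = j) := fun h => h' (Prod.ext h.1 h.2)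
        simp [nilssonOp_apply, e, h, h'']
  have hV' : ∀ v ∈ V, q • (eulerOp ℂ v + (C (α : ℂ) : ℂ[X]) • v) ∈ V := fun v hv => by
    rw [smul_add]
    exact V.add_mem (hqV v hv) (V.smul_mem _ (V.smul_mem _ hv))
  -- lower powers of the logarithm are added one at a time
  have key : ∀ j, ∃ W : Submodule ℂ[X] (ℚ × ℕ → PowerSeries ℂ), W.FG ∧ (∀ v ∈ V, e j v ∈ W) ∧
      ∀ w ∈ W, q • nilssonOp w ∈ W := by
    intro j
    induction j with
    | zero =>
      refine ⟨V.map (e 0), hV.map _, fun v hv => Submodule.mem_map_of_mem hv, ?_⟩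
      rintro _ ⟨v, hv, rfl⟩
      rw [he0, ← map_smul (e 0)]
      exact Submodule.mem_map_of_mem (hV' v hv)
    | succ j ih =>
      obtain ⟨W, hW, hVW, hqW⟩ := ih
      refine ⟨W ⊔ V.map (e (j + 1)), hW.sup (hV.map _),
        fun v hv => Submodule.mem_sup_right (Submodule.mem_map_of_mem hv), fun w hw => ?_⟩
      obtain ⟨a, ha, _, ⟨v, hv, rfl⟩, rfl⟩ := Submodule.mem_sup.1 hw
      rw [map_add, heS, smul_add, smul_add, ← map_smul (e (j + 1))]
      exact Submodule.add_mem _ (Submodule.mem_sup_left (hqW a ha)) (Submodule.add_mem _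
        (Submodule.mem_sup_right (Submodule.mem_map_of_mem (hV' v hv)))
        (Submodule.mem_sup_left (W.smul_mem _ (nsmul_mem (hVW v hv) (j + 1)))))
  obtain ⟨W, hW, hVW, hqW⟩ := key j
  exact ⟨W, hW, hVW F hFV, q, hq, hqW⟩

/-- The coefficients of the highest power of the logarithm are differentially finite on their own;
they are removed and the argument is repeated. -/
theorem IsDFinite.nilsson_coeff {E : Finset ℚ} {J : ℕ} {G : ℚ × ℕ → PowerSeries ℂ}
    (hG : IsDFinite ℂ nilssonOp G) (hE : ∀ s : ℚ × ℕ, s.1 ∉ E → G s = 0)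
    (hJ : G ∈ logDegreeLT J) (s : ℚ × ℕ) : IsDFinite ℂ (eulerOp ℂ) (G s) := by
  induction J generalizing G s with
  | zero =>
    rw [hJ s (Nat.zero_le _)]
    exact IsDFinite.zero
  | succ J ih =>
    have htop : ∀ α, IsDFinite ℂ (eulerOp ℂ) (G (α, J)) := fun α =>
      hG.map_of_stable (logDegreeLT (J + 1)) (fun _ => nilssonOp_mem_logDegreeLT) hJ
        (LinearMap.proj (α, J)) (C (α : ℂ)) fun n hn => by
          simp [nilssonOp_apply, hn (α, J + 1) le_rfl]
    let T : ℚ × ℕ → PowerSeries ℂ := ∑ α ∈ E, Pi.single (α, J) (G (α, J))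
    have hT : ∀ α i, T (α, i) = if i = J then G (α, J) else 0 := by
      intro α i
      simp only [T, Finset.sum_apply, Pi.single_apply, Prod.mk.injEq]
      split_ifs with h
      · subst h
        by_cases hα : α ∈ E
        · simp [hα]
        · simp [hα, hE (α, i) hα]
      · simp [h]
    have hTfin : IsDFinite ℂ nilssonOp T := IsDFinite.sum _ fun α _ => isDFinite_single _ (htop α)
    have hrest := ih (G := G - T) (hG.sub hTfin)
      (fun s hs => by
        obtain ⟨α, i⟩ := s
        simp only [Pi.sub_apply, hT, hE _ hs, hE (α, J) hs, ite_self, sub_zero])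
      (fun s hs => by
        obtain ⟨α, i⟩ := s
        rw [Pi.sub_apply, hT]
        split_ifs with h
        · rw [h, sub_self]
        · rw [hJ (α, i) (by simp at hs ⊢; omega), sub_zero])
    obtain ⟨α, i⟩ := s
    by_cases h : i = J
    · rw [h]
      exact htop α
    · have := hrest (α, i)
      rwa [Pi.sub_apply, hT, if_neg h, sub_zero] at this

end Series

/-! ### Descent of holonomicity by specialization -/

section Specialization

open Polynomial

/-- A consequence of the Nullstellensatz: the points of an affine variety over an algebraically
closed field detect its nonzero functions. -/
theorem exists_algHom_apply_ne_zero {K A : Type*} [Field K] [IsAlgClosed K] [CommRing A]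
    [IsDomain A] [Algebra K A] [Algebra.FiniteType K A] {a : A} (ha : a ≠ 0) :
    ∃ φ : A →ₐ[K] K, φ a ≠ 0 := by
  have : IsJacobsonRing A := isJacobsonRing_of_finiteType (A := K)
  have hbot : (⊥ : Ideal A).jacobson = ⊥ :=
    isJacobsonRing_iff.1 this _ (Ideal.isPrime_bot (α := A)).isRadical
  have hmem : a ∉ (⊥ : Ideal A).jacobson := by
    rw [hbot]
    simpa using ha
  rw [Ideal.jacobson, Ideal.mem_sInf] at hmem
  push Not at hmem
  obtain ⟨m, ⟨-, hm⟩, ham⟩ := hmem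
  let _ := Ideal.Quotient.field m
  have : Algebra.FiniteType K (A ⧸ m) := inferInstance
  have : Module.Finite K (A ⧸ m) := finite_of_finite_type_of_isJacobsonRing K (A ⧸ m)
  let ψ : (A ⧸ m) →ₐ[K] K := IsAlgClosed.lift
  refine ⟨ψ.comp (Ideal.Quotient.mkₐ K m), ?_⟩
  have : Ideal.Quotient.mk m a ≠ 0 := fun h => ham (Ideal.Quotient.eq_zero_iff_mem.1 h)
  simpa using this

/-- Descent of holonomicity. The vectors `v` with `∑ vₖ fₖ` holonomic over `K` form a subspace `V`
of `Kⁿ`. Specializing the coefficients `c` and those of the equation to points of `K` gives vectors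
of `V`, so `c` satisfies the linear equations of `V`; a projection onto `V` rewrites the sum. -/
theorem exists_holonomic_decomposition {K L ι : Type*} [Field K] [IsAlgClosed K] [Field L]
    [Algebra K L] [Fintype ι] (f : ι → PowerSeries K) (c : ι → L)
    (h : Nilsson.IsHolonomicSeries (∑ k, c k • PowerSeries.map (algebraMap K L) (f k))) :
    ∃ P : ι → ι → K, (∀ l, Nilsson.IsHolonomicSeries (∑ k, P l k • f k)) ∧
      ∀ k, c k = ∑ l, c l * algebraMap K L (P l k) := by
  classical
  obtain ⟨N, p, ⟨i₀, hi₀, hpi₀⟩, hp⟩ := h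
  let S : Set L := Set.range c ∪ ⋃ i ∈ Finset.range (N + 1), ((p i).coeffs : Set L)
  have hS : S.Finite := (Set.finite_range c).union
    ((Finset.finite_toSet _).biUnion fun i _ => (p i).coeffs.finite_toSet)
  let A := Algebra.adjoin K S
  have hft : Algebra.FiniteType K A :=
    A.fg_iff_finiteType.1 (Subalgebra.fg_def.2 ⟨S, hS, rfl⟩)
  have hinj : Function.Injective (algebraMap A L) := Subtype.val_injective
  have hlift : ∀ i, ∃ q : A[X], i ≤ N → q.map (algebraMap A L) = p i := by
    intro i
    by_cases hi : i ≤ N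
    · have hl : p i ∈ lifts (algebraMap A L) := by
        rw [lifts_iff_coeff_lifts]
        intro n
        by_cases hn : (p i).coeff n = 0
        · exact ⟨0, by rw [hn, map_zero]⟩
        · refine ⟨⟨(p i).coeff n, Algebra.subset_adjoin (Or.inr ?_)⟩, rfl⟩
          simp only [Set.mem_iUnion]
          exact ⟨i, by simp; omega, coeff_mem_coeffs hn⟩
      obtain ⟨q, hq⟩ := (mem_lifts _).1 hl
      exact ⟨q, fun _ => hq⟩
    · exact ⟨0, fun h => absurd h hi⟩
  choose q hq using hlift
  let cA : ι → A := fun k => ⟨c k, Algebra.subset_adjoin (Or.inl ⟨k, rfl⟩)⟩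
  let gA : PowerSeries A := ∑ k, cA k • PowerSeries.map (algebraMap K A) (f k)
  have hgA : PowerSeries.map (algebraMap A L) gA
      = ∑ k, c k • PowerSeries.map (algebraMap K L) (f k) := by
    ext n
    simp only [gA, PowerSeries.coeff_map, map_sum, PowerSeries.coeff_smul, map_mul,
      smul_eq_mul]
    rfl
  have heq : ∑ i ∈ Finset.range (N + 1), (q i : PowerSeries A) *
      (PowerSeries.derivative A)^[i] gA = 0 := by
    apply PowerSeries.map_injective _ hinj
    rw [map_zero, ← hp, map_sum]
    refine Finset.sum_congr rfl fun i hi => ?_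
    rw [map_mul, map_polynomial_coe, hq i (Nat.lt_succ_iff.1 (Finset.mem_range.1 hi)),
      ← derivative_iterate_map, hgA]
  obtain ⟨n₀, hn₀⟩ : ∃ n, (q i₀).coeff n ≠ 0 := by
    by_contra! hzero
    refine hpi₀ ?_
    rw [← hq i₀ hi₀, show q i₀ = 0 from Polynomial.ext hzero, Polynomial.map_zero]
  have hspec : ∀ φ : A →ₐ[K] K, φ ((q i₀).coeff n₀) ≠ 0 →
      Nilsson.IsHolonomicSeries (∑ k, φ (cA k) • f k) := by
    intro φ hφ
    refine ⟨N, fun i => (q i).map (φ : A →+* K), ⟨i₀, hi₀, fun h0 => hφ ?_⟩, ?_⟩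
    · simpa using congrArg (fun r => coeff r n₀) h0
    · have hg : PowerSeries.map (φ : A →+* K) gA = ∑ k, φ (cA k) • f k := by
        ext n
        simp [gA]
      rw [← map_zero (PowerSeries.map (φ : A →+* K)), ← heq, map_sum]
      refine Finset.sum_congr rfl fun i _ => ?_
      rw [map_mul, map_polynomial_coe, ← derivative_iterate_map, hg]
  let Φ : (ι → K) →ₗ[K] PowerSeries K := Fintype.linearCombination K f
  let V : Submodule K (ι → K) := (holonomicSubmodule K).comap Φ
  have hV : ∀ v, v ∈ V ↔ Nilsson.IsHolonomicSeries (∑ k, v k • f k) := fun v => Iff.rfl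
  obtain ⟨π, hπ⟩ := LinearMap.exists_leftInverse_of_injective V.subtype V.ker_subtype
  have hπV : ∀ v ∈ V, (π v : ι → K) = v := fun v hv => by
    have := LinearMap.congr_fun hπ ⟨v, hv⟩
    simpa using congrArg Subtype.val this
  have hπsum : ∀ (v : ι → K) (k : ι),
      (π v : ι → K) k = ∑ l, v l * (π (Pi.single l 1) : ι → K) k := by
    intro v k
    conv_lhs => rw [pi_eq_sum_univ' v]
    simp [map_sum, map_smul]
  refine ⟨fun l => π (Pi.single l 1), fun l => (hV _).1 (π _).2, fun k => ?_⟩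
  let μ : A := cA k - ∑ l, cA l * algebraMap K A ((π (Pi.single l 1) : ι → K) k)
  have hμ : μ = 0 := by
    by_contra hne
    obtain ⟨φ, hφ⟩ := exists_algHom_apply_ne_zero (K := K) (mul_ne_zero hne hn₀)
    rw [map_mul] at hφ
    have hmem := (hV fun l => φ (cA l)).2 (hspec φ (right_ne_zero_of_mul hφ))
    refine left_ne_zero_of_mul hφ ?_
    have h1 := hπsum (fun l => φ (cA l)) k
    rw [hπV _ hmem] at h1
    simp only [μ, map_sub, map_sum, map_mul, AlgHom.commutes]
    rw [sub_eq_zero]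
    exact h1
  have := congrArg (algebraMap A L) (sub_eq_zero.1 hμ)
  simpa [cA] using this

end Specialization

/-! ### Arithmetic growth conditions -/

namespace Nilsson

local notation "ℚbar" => AlgebraicClosure ℚ

variable {ι : ℚbar →+* ℂ} {F G : PowerSeries ℚbar}

theorem IsArithmeticGevrey.add (hF : IsArithmeticGevrey ι F) (hG : IsArithmeticGevrey ι G) :
    IsArithmeticGevrey ι (F + G) := by
  obtain ⟨C, hC, hFC, d, hd⟩ := hF
  obtain ⟨C', hC', hGC, d', hd'⟩ := hG
  -- the modulus needs `C + C'` and the denominator `C * C'`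
  refine ⟨(C + C') + C * C', by positivity, fun σ n => ?_, fun n => d n * d' n, fun n => ?_⟩
  · rw [map_add, map_add, map_add]
    calc _ ≤ C ^ (n + 1) + C' ^ (n + 1) := (norm_add_le _ _).trans (add_le_add (hFC σ n) (hGC σ n))
      _ ≤ (C + C') ^ (n + 1) := pow_add_pow_le hC.le hC'.le (Nat.succ_ne_zero n)
      _ ≤ _ := by
        refine pow_le_pow_left₀ (by positivity) ?_ _
        have := mul_pos hC hC'
        linarith
  · obtain ⟨h1, h2, h3⟩ := hd n
    obtain ⟨h1', h2', h3'⟩ := hd' n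
    refine ⟨Nat.mul_pos h1 h1', ?_, fun m hm => ?_⟩
    · push_cast
      calc _ ≤ C ^ (n + 1) * C' ^ (n + 1) := by gcongr
        _ = (C * C') ^ (n + 1) := (mul_pow _ _ _).symm
        _ ≤ _ := by
          refine pow_le_pow_left₀ (by positivity) ?_ _
          linarith
    · have h4 : ((d n * d' n : ℕ) : ℚbar) * PowerSeries.coeff m (F + G)
          = (d' n : ℚbar) * ((d n : ℚbar) * PowerSeries.coeff m F)
            + (d n : ℚbar) * ((d' n : ℚbar) * PowerSeries.coeff m G) := by
        rw [map_add]
        push_cast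
        ring
      rw [h4]
      exact ((isIntegral_natCast _).mul (h3 m hm)).add ((isIntegral_natCast _).mul (h3' m hm))

theorem isArithmeticGevrey_zero : IsArithmeticGevrey ι 0 :=
  ⟨1, one_pos, fun σ n => by simp, fun _ => 1, fun n => by simp [isIntegral_zero]⟩

theorem IsArithmeticGevrey.sum {κ : Type*} (s : Finset κ) {F : κ → PowerSeries ℚbar}
    (h : ∀ k ∈ s, IsArithmeticGevrey ι (F k)) : IsArithmeticGevrey ι (∑ k ∈ s, F k) :=
  Finset.sum_induction _ (IsArithmeticGevrey ι) (fun _ _ => .add) isArithmeticGevrey_zero h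

theorem algebra_isAlgebraic_rat : Algebra.IsAlgebraic ℚ ℚbar := by
  -- the two `ℚ`-algebra structures on `ℚbar` agree
  have h : AlgebraicClosure.instAlgebra ℚ = DivisionRing.toRatAlgebra := Subsingleton.elim _ _
  exact h ▸ AlgebraicClosure.isAlgebraic ℚ

theorem exists_conjugate_norm_le (ι : ℚbar →+* ℂ) (a : ℚbar) :
    ∃ B : ℝ, 1 ≤ B ∧ ∀ σ : ℚbar ≃ₐ[ℚ] ℚbar, ‖ι (σ a)‖ ≤ B := by
  have hfin : ((minpoly ℚ a).rootSet ℚbar).Finite := (minpoly ℚ a).rootSet_finite ℚbar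
  obtain ⟨B, hB⟩ := (hfin.image fun b => ‖ι b‖).bddAbove
  refine ⟨max 1 B, le_max_left _ _, fun σ => (hB ⟨σ a, ?_, rfl⟩).trans (le_max_right _ _)⟩
  have ha : IsIntegral ℚ a := (algebra_isAlgebraic_rat.isAlgebraic a).isIntegral
  rw [Polynomial.mem_rootSet_of_ne (minpoly.ne_zero ha)]
  have := Polynomial.aeval_algHom_apply (σ : ℚbar →ₐ[ℚ] ℚbar) a (minpoly ℚ a)
  simpa using this

theorem exists_nat_mul_isIntegral (a : ℚbar) :
    ∃ d : ℕ, 0 < d ∧ IsIntegral ℤ ((d : ℚbar) * a) := by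
  have ha : IsAlgebraic ℤ a :=
    (IsFractionRing.isAlgebraic_iff ℤ ℚ ℚbar).2 (algebra_isAlgebraic_rat.isAlgebraic a)
  obtain ⟨y, hy, h⟩ := ha.exists_integral_multiple
  refine ⟨y.natAbs, Int.natAbs_pos.2 hy, ?_⟩
  rw [Algebra.smul_def] at h
  have hy' : ((y.natAbs : ℕ) : ℚbar) = ((y.natAbs : ℤ) : ℚbar) := by simp
  rcases Int.natAbs_eq y with h' | h'
  · rw [hy', ← h']
    simpa using h
  · rw [hy', ← neg_eq_iff_eq_neg.2 h']
    simpa using h.neg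

theorem IsArithmeticGevrey.smul (a : ℚbar) (hF : IsArithmeticGevrey ι F) :
    IsArithmeticGevrey ι (a • F) := by
  obtain ⟨C, hC, hFC, d, hd⟩ := hF
  obtain ⟨B, hB1, hB⟩ := exists_conjugate_norm_le ι a
  obtain ⟨e, he, hea⟩ := exists_nat_mul_isIntegral a
  have he1 : (1 : ℝ) ≤ e := by exact_mod_cast he
  refine ⟨B * e * C, by positivity, fun σ n => ?_, fun n => e * d n, fun n => ?_⟩
  · rw [PowerSeries.coeff_smul, smul_eq_mul, map_mul, map_mul, norm_mul, mul_pow]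
    refine mul_le_mul ?_ (hFC σ n) (norm_nonneg _) (by positivity)
    calc _ ≤ B := hB σ
      _ ≤ B * e := le_mul_of_one_le_right (by positivity) he1
      _ ≤ _ := le_self_pow₀ (one_le_mul_of_one_le_of_one_le hB1 he1) (Nat.succ_ne_zero n)
  · obtain ⟨h1, h2, h3⟩ := hd n
    refine ⟨Nat.mul_pos he h1, ?_, fun m hm => ?_⟩
    · push_cast
      rw [mul_pow]
      refine mul_le_mul ?_ h2 (by positivity) (by positivity)
      calc (e : ℝ) ≤ B * e := le_mul_of_one_le_left (by positivity) hB1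
        _ ≤ _ := le_self_pow₀ (one_le_mul_of_one_le_of_one_le hB1 he1) (Nat.succ_ne_zero n)
    · have h4 : ((e * d n : ℕ) : ℚbar) * PowerSeries.coeff m (a • F)
          = ((e : ℚbar) * a) * ((d n : ℚbar) * PowerSeries.coeff m F) := by
        rw [PowerSeries.coeff_smul, smul_eq_mul]
        push_cast
        ring
      rw [h4]
      exact hea.mul (h3 m hm)

theorem IsArithmeticGevrey.X_pow_mul (k : ℕ) (hF : IsArithmeticGevrey ι F) :
    IsArithmeticGevrey ι (PowerSeries.X ^ k * F) := by
  obtain ⟨C, hC, hFC, d, hd⟩ := hF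
  -- `1 ≤ d 0 ≤ C`, so the bounds `C ^ (n + 1)` increase with `n`
  have hC1 : 1 ≤ C := by
    have h1 : (1 : ℝ) ≤ d 0 := by exact_mod_cast (hd 0).1
    simpa using h1.trans (hd 0).2.1
  refine ⟨C, hC, fun σ n => ?_, d, fun n => ⟨(hd n).1, (hd n).2.1, fun m hm => ?_⟩⟩
  · rw [PowerSeries.coeff_X_pow_mul']
    split_ifs with h
    · exact (hFC σ _).trans (pow_le_pow_right₀ hC1 (by omega))
    · simp only [map_zero, norm_zero]
      positivity
  · rw [PowerSeries.coeff_X_pow_mul']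
    split_ifs with h
    · exact (hd n).2.2 _ (by omega)
    · rw [mul_zero]
      exact isIntegral_zero

end Nilsson

/-! ### Convergent series and the analytic functions of formal sums -/

section ConvergentSeries

open scoped Polynomial

/-- The series `g` converges on the open disc of radius `r` around the origin. -/
def ConvergesOn (r : ℝ) (g : PowerSeries ℂ) : Prop :=
  ∀ z : ℂ, ‖z‖ < r → Summable fun n => PowerSeries.coeff n g * z ^ n

/-- The sum of a power series with complex coefficients. -/
noncomputable def powerSum (g : PowerSeries ℂ) (z : ℂ) : ℂ :=
  ∑' n, PowerSeries.coeff n g * z ^ n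

theorem convergesOn_polynomial (r : ℝ) (p : ℂ[X]) : ConvergesOn r (p : PowerSeries ℂ) := by
  intro z _
  refine summable_of_ne_finset_zero (s := p.support) fun n hn => ?_
  rw [Polynomial.coeff_coe, Polynomial.notMem_support_iff.1 hn, zero_mul]

theorem powerSum_polynomial (p : ℂ[X]) (z : ℂ) : powerSum (p : PowerSeries ℂ) z = p.eval z := by
  rw [powerSum, Polynomial.eval_eq_sum, Polynomial.sum]
  simp only [Polynomial.coeff_coe]
  exact tsum_eq_sum fun n hn => by rw [Polynomial.notMem_support_iff.1 hn, zero_mul]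

@[simp] theorem powerSum_zero (z : ℂ) : powerSum 0 z = 0 := by
  simp [powerSum]

theorem powerSum_at_zero (g : PowerSeries ℂ) : powerSum g 0 = PowerSeries.constantCoeff g := by
  rw [powerSum, tsum_eq_single 0 fun n hn => by rw [zero_pow hn, mul_zero]]
  simp

namespace ConvergesOn

variable {r : ℝ} {f g : PowerSeries ℂ} {z : ℂ}

theorem zero (r : ℝ) : ConvergesOn r 0 := fun z _ => by simp [summable_zero]

theorem mono {r' : ℝ} (hg : ConvergesOn r g) (h : r' ≤ r) : ConvergesOn r' g :=
  fun z hz => hg z (hz.trans_le h)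

theorem add (hf : ConvergesOn r f) (hg : ConvergesOn r g) : ConvergesOn r (f + g) :=
  fun z hz => by simpa [add_mul] using (hf z hz).add (hg z hz)

theorem powerSum_add (hf : ConvergesOn r f) (hg : ConvergesOn r g) (hz : ‖z‖ < r) :
    powerSum (f + g) z = powerSum f z + powerSum g z := by
  simp only [powerSum, map_add, add_mul]
  exact (hf z hz).tsum_add (hg z hz)

theorem coeff_mul_mul_pow (f g : PowerSeries ℂ) (z : ℂ) (n : ℕ) :
    PowerSeries.coeff n (f * g) * z ^ n = ∑ kl ∈ Finset.HasAntidiagonal.antidiagonal n,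
      (PowerSeries.coeff kl.1 f * z ^ kl.1) * (PowerSeries.coeff kl.2 g * z ^ kl.2) := by
  rw [PowerSeries.coeff_mul, Finset.sum_mul]
  refine Finset.sum_congr rfl fun kl hkl => ?_
  rw [← Finset.HasAntidiagonal.mem_antidiagonal.1 hkl, pow_add]
  ring

theorem mul (hf : ConvergesOn r f) (hg : ConvergesOn r g) : ConvergesOn r (f * g) := by
  intro z hz
  simp only [coeff_mul_mul_pow]
  exact (summable_norm_sum_mul_antidiagonal_of_summable_norm (hf z hz).norm (hg z hz).norm).of_norm

theorem powerSum_mul (hf : ConvergesOn r f) (hg : ConvergesOn r g) (hz : ‖z‖ < r) :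
    powerSum (f * g) z = powerSum f z * powerSum g z := by
  simp only [powerSum, coeff_mul_mul_pow]
  exact (tsum_mul_tsum_eq_tsum_sum_antidiagonal_of_summable_norm
    (hf z hz).norm (hg z hz).norm).symm

theorem smul (p : ℂ[X]) (hg : ConvergesOn r g) : ConvergesOn r (p • g) := by
  rw [polynomial_smul_eq]
  exact (convergesOn_polynomial r p).mul hg

theorem powerSum_smul (p : ℂ[X]) (hg : ConvergesOn r g) (hz : ‖z‖ < r) :
    powerSum (p • g) z = p.eval z * powerSum g z := by
  rw [polynomial_smul_eq, (convergesOn_polynomial r p).powerSum_mul hg hz, powerSum_polynomial]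

theorem sum {ι : Type*} (s : Finset ι) {g : ι → PowerSeries ℂ}
    (hg : ∀ i ∈ s, ConvergesOn r (g i)) : ConvergesOn r (∑ i ∈ s, g i) :=
  Finset.sum_induction _ (ConvergesOn r) (fun _ _ => add) (zero r) hg

theorem powerSum_sum {ι : Type*} (s : Finset ι) {g : ι → PowerSeries ℂ}
    (hg : ∀ i ∈ s, ConvergesOn r (g i)) (hz : ‖z‖ < r) :
    powerSum (∑ i ∈ s, g i) z = ∑ i ∈ s, powerSum (g i) z := by
  classical
  induction s using Finset.induction_on with
  | empty => simp
  | insert a s ha ih =>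
    have hs : ∀ i ∈ s, ConvergesOn r (g i) := fun i hi => hg i (Finset.mem_insert_of_mem hi)
    rw [Finset.sum_insert ha, Finset.sum_insert ha,
      (hg a (Finset.mem_insert_self a s)).powerSum_add (sum s hs) hz, ih hs]

theorem hasFPowerSeriesOnBall (hr : 0 < r) (hg : ConvergesOn r g) :
    HasFPowerSeriesOnBall (powerSum g)
      (FormalMultilinearSeries.ofScalars ℂ fun n => PowerSeries.coeff n g) 0 (ENNReal.ofReal r) := by
  set p := FormalMultilinearSeries.ofScalars ℂ fun n => PowerSeries.coeff n g
  have hrad : ENNReal.ofReal r ≤ p.radius := by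
    refine le_of_forall_lt_imp_le_of_dense fun s hs => ?_
    lift s to NNReal using hs.ne_top
    refine p.le_radius_of_summable ?_
    have hs' : (s : ℝ) < r := by
      rwa [← ENNReal.ofReal_coe_nnreal, ENNReal.ofReal_lt_ofReal_iff hr] at hs
    have := (hg (s : ℝ) (by simpa using hs')).norm
    simpa [p, FormalMultilinearSeries.ofScalars_norm] using this
  have h := (p.hasFPowerSeriesOnBall ((ENNReal.ofReal_pos.2 hr).trans_le hrad)).mono
    (ENNReal.ofReal_pos.2 hr) hrad
  have hsum : p.sum = powerSum g := by
    ext z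
    simp [FormalMultilinearSeries.sum, p, powerSum, mul_comm]
  rwa [hsum] at h

theorem differentiableOn (hr : 0 < r) (hg : ConvergesOn r g) :
    DifferentiableOn ℂ (powerSum g) (Metric.ball 0 r) := by
  have := (hg.hasFPowerSeriesOnBall hr).differentiableOn
  rwa [Metric.eball_ofReal] at this

theorem iteratedDeriv_zero (hr : 0 < r) (hg : ConvergesOn r g) (n : ℕ) :
    iteratedDeriv n (powerSum g) 0 = n.factorial * PowerSeries.coeff n g := by
  have := (hg.hasFPowerSeriesOnBall hr).factorial_smul 1 n
  rw [iteratedDeriv_eq_iteratedFDeriv, ← this]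
  simp

theorem hasSum_derivative (hr : 0 < r) (hg : ConvergesOn r g) (hz : ‖z‖ < r) :
    HasSum (fun n => PowerSeries.coeff n (PowerSeries.derivative ℂ g) * z ^ n)
      (deriv (powerSum g) z) := by
  have hd := (hg.differentiableOn hr).deriv Metric.isOpen_ball
  have h := Complex.hasSum_taylorSeries_on_ball hd (show z ∈ Metric.ball (0 : ℂ) r by simpa using hz)
  suffices hcoeff : (fun n => PowerSeries.coeff n (PowerSeries.derivative ℂ g) * z ^ n)
      = fun n => (n.factorial : ℂ)⁻¹ • (z - 0) ^ n • iteratedDeriv n (deriv (powerSum g)) 0 by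
    rw [hcoeff]
    exact h
  ext n
  rw [← iteratedDeriv_succ', hg.iteratedDeriv_zero hr, PowerSeries.coeff_derivative, sub_zero,
    Nat.factorial_succ]
  have : (n.factorial : ℂ) ≠ 0 := by exact_mod_cast n.factorial_ne_zero
  simp only [smul_eq_mul]
  push_cast
  field_simp

theorem derivative (hg : ConvergesOn r g) : ConvergesOn r (PowerSeries.derivative ℂ g) :=
  fun _ hz => (hg.hasSum_derivative ((norm_nonneg _).trans_lt hz) hz).summable

theorem hasDerivAt (hg : ConvergesOn r g) (hz : ‖z‖ < r) :
    HasDerivAt (powerSum g) (powerSum (PowerSeries.derivative ℂ g) z) z := by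
  have hr := (norm_nonneg _).trans_lt hz
  rw [powerSum, (hg.hasSum_derivative hr hz).tsum_eq]
  exact ((hg.differentiableOn hr).differentiableAt
    (Metric.isOpen_ball.mem_nhds (by simpa using hz))).hasDerivAt

theorem X_mul (hg : ConvergesOn r g) : ConvergesOn r (PowerSeries.X * g) := by
  have := hg.smul Polynomial.X
  rwa [polynomial_smul_eq, Polynomial.coe_X] at this

theorem eulerOp (hg : ConvergesOn r g) : ConvergesOn r (eulerOp ℂ g) :=
  hg.derivative.X_mul

theorem powerSum_eulerOp (hg : ConvergesOn r g) (hz : ‖z‖ < r) :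
    powerSum (_root_.eulerOp ℂ g) z = z * powerSum (PowerSeries.derivative ℂ g) z := by
  have := hg.derivative.powerSum_smul Polynomial.X hz
  rwa [polynomial_smul_eq, Polynomial.coe_X, Polynomial.eval_X] at this

theorem nsmul (k : ℕ) (hg : ConvergesOn r g) : ConvergesOn r (k • g) := by
  rw [← Nat.cast_smul_eq_nsmul ℂ[X]]
  exact hg.smul _

theorem powerSum_nsmul (k : ℕ) (hg : ConvergesOn r g) (hz : ‖z‖ < r) :
    powerSum (k • g) z = k * powerSum g z := by
  rw [← Nat.cast_smul_eq_nsmul ℂ[X], hg.powerSum_smul _ hz, Polynomial.eval_natCast]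

theorem of_X_pow_mul {m : ℕ} (hg : ConvergesOn r (PowerSeries.X ^ m * g)) : ConvergesOn r g := by
  intro z hz
  by_cases h0 : z = 0
  · subst h0
    exact summable_of_ne_finset_zero (s := {0}) fun n hn => by
      rw [zero_pow (by simpa using hn), mul_zero]
  · have h := ((summable_nat_add_iff m).2 (hg z hz)).mul_right ((z ^ m)⁻¹)
    refine h.congr fun n => ?_
    rw [add_comm n m, PowerSeries.coeff_X_pow_mul', if_pos (Nat.le_add_right m n),
      Nat.add_sub_cancel_left, pow_add]
    field_simp

end ConvergesOn

/-- The value at `exp w` of the formal sum `∑ z^α log(z)^j G (α, j)`, restricted to exponents in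
`E` and to powers of the logarithm less than `J`, for the determination of the logarithm that takes
the value `w` there. -/
noncomputable def nilssonEval (E : Finset ℚ) (J : ℕ) (G : ℚ × ℕ → PowerSeries ℂ) (w : ℂ) : ℂ :=
  ∑ α ∈ E, ∑ j ∈ Finset.range J,
    Complex.exp ((α : ℂ) * w) * w ^ j * powerSum (G (α, j)) (Complex.exp w)

section Evaluation

variable {r : ℝ} {E : Finset ℚ} {J : ℕ} {G : ℚ × ℕ → PowerSeries ℂ} {w : ℂ}

theorem convergesOn_nilssonOp (hG : ∀ s, ConvergesOn r (G s)) (s : ℚ × ℕ) :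
    ConvergesOn r (nilssonOp G s) :=
  ((hG s).eulerOp.add ((hG s).smul _)).add ((hG _).nsmul _)

theorem hasDerivAt_nilssonEval (hG : ∀ s, ConvergesOn r (G s)) (hJ : G ∈ logDegreeLT J)
    (hw : ‖Complex.exp w‖ < r) :
    HasDerivAt (nilssonEval E J G) (nilssonEval E J (nilssonOp G) w) w := by
  have hterm : ∀ α : ℚ, ∀ j : ℕ, HasDerivAt
      (fun w => Complex.exp ((α : ℂ) * w) * w ^ j * powerSum (G (α, j)) (Complex.exp w))
      (Complex.exp ((α : ℂ) * w) * w ^ j * ((α : ℂ) * powerSum (G (α, j)) (Complex.exp w)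
          + powerSum (eulerOp ℂ (G (α, j))) (Complex.exp w))
        + Complex.exp ((α : ℂ) * w) * (j * w ^ (j - 1) * powerSum (G (α, j)) (Complex.exp w))) w := by
    intro α j
    have h1 : HasDerivAt (fun w : ℂ => Complex.exp ((α : ℂ) * w))
        (Complex.exp ((α : ℂ) * w) * α) w := by
      simpa using ((hasDerivAt_id w).const_mul (α : ℂ)).cexp
    have h2 := hasDerivAt_pow j w
    have h3 := ((hG (α, j)).hasDerivAt hw).comp w (Complex.hasDerivAt_exp w)
    refine ((h1.mul h2).mul h3).congr_deriv ?_
    rw [(hG (α, j)).powerSum_eulerOp hw]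
    simp only [Function.comp_apply, Pi.mul_apply]
    ring
  have hsum := HasDerivAt.fun_sum (u := E) fun α _ =>
    HasDerivAt.fun_sum (u := Finset.range J) fun j _ => hterm α j
  refine hsum.congr_deriv (Finset.sum_congr rfl fun α _ => ?_)
  -- differentiating the powers of `w` shifts the index by one
  have hshift : ∑ j ∈ Finset.range J,
        Complex.exp ((α : ℂ) * w) * (j * w ^ (j - 1) * powerSum (G (α, j)) (Complex.exp w))
      = ∑ j ∈ Finset.range J, Complex.exp ((α : ℂ) * w) * w ^ j *
        (((j + 1 : ℕ) : ℂ) * powerSum (G (α, j + 1)) (Complex.exp w)) := by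
    have h := Finset.sum_range_succ (fun j : ℕ => Complex.exp ((α : ℂ) * w) *
      (j * w ^ (j - 1) * powerSum (G (α, j)) (Complex.exp w))) J
    rw [Finset.sum_range_succ', hJ (α, J) le_rfl] at h
    simp only [Nat.cast_zero, zero_mul, mul_zero, add_zero, powerSum_zero] at h
    rw [← h]
    refine Finset.sum_congr rfl fun j _ => ?_
    rw [Nat.add_sub_cancel]
    ring
  rw [Finset.sum_add_distrib, hshift, ← Finset.sum_add_distrib]
  refine Finset.sum_congr rfl fun j _ => ?_
  rw [nilssonOp_apply, ((hG _).eulerOp.add ((hG _).smul _)).powerSum_add ((hG _).nsmul _) hw,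
    (hG _).eulerOp.powerSum_add ((hG _).smul _) hw, (hG _).powerSum_smul _ hw,
    (hG _).powerSum_nsmul _ hw, Polynomial.eval_C]
  ring

theorem nilssonEval_smul (p : ℂ[X]) (hG : ∀ s, ConvergesOn r (G s)) (hw : ‖Complex.exp w‖ < r) :
    nilssonEval E J (p • G) w = p.eval (Complex.exp w) * nilssonEval E J G w := by
  simp only [nilssonEval, Finset.mul_sum, Pi.smul_apply, (hG _).powerSum_smul p hw]
  refine Finset.sum_congr rfl fun α _ => Finset.sum_congr rfl fun j _ => ?_
  ring

theorem nilssonEval_sum {ι : Type*} (s : Finset ι) {G : ι → ℚ × ℕ → PowerSeries ℂ}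
    (hG : ∀ i t, ConvergesOn r (G i t)) (hw : ‖Complex.exp w‖ < r) :
    nilssonEval E J (∑ i ∈ s, G i) w = ∑ i ∈ s, nilssonEval E J (G i) w := by
  simp only [nilssonEval, Finset.sum_apply, ConvergesOn.powerSum_sum s (fun i _ => hG i _) hw,
    Finset.mul_sum]
  rw [Finset.sum_comm]
  conv_rhs => rw [Finset.sum_comm]
  rw [Finset.sum_comm]
  refine Finset.sum_congr rfl fun α _ => ?_
  rw [Finset.sum_comm]

theorem fallingOp_nilssonOp_mem (hG : ∀ s, ConvergesOn r (G s)) (hJ : G ∈ logDegreeLT J) (i : ℕ) :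
    (∀ s, ConvergesOn r (fallingOp nilssonOp i G s)) ∧ fallingOp nilssonOp i G ∈ logDegreeLT J := by
  induction i with
  | zero => exact ⟨hG, hJ⟩
  | succ i ih =>
    refine ⟨fun s => ?_, Submodule.sub_mem _ (nilssonOp_mem_logDegreeLT ih.2) (nsmul_mem ih.2 i)⟩
    have : fallingOp nilssonOp (i + 1) G s = nilssonOp (fallingOp nilssonOp i G) s
        + (-(i : ℂ[X])) • fallingOp nilssonOp i G s := by
      rw [neg_smul, Nat.cast_smul_eq_nsmul, ← sub_eq_add_neg]
      rfl
    rw [this]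
    exact (convergesOn_nilssonOp ih.1 s).add ((ih.1 s).smul _)

theorem Nilsson.IsLogDetermination.hasDerivAt {Ω : Set ℂ} {ℓ : ℂ → ℂ}
    (h : Nilsson.IsLogDetermination Ω ℓ) {z : ℂ} (hz : z ∈ Ω) : HasDerivAt ℓ z⁻¹ z := by
  have hΩ := h.isOpen.mem_nhds hz
  have hexp := Complex.hasDerivAt_exp (ℓ z)
  rw [h.exp_eq z hz] at hexp
  have hz0 : z ≠ 0 := by
    rw [← h.exp_eq z hz]
    exact Complex.exp_ne_zero _
  exact HasDerivAt.of_local_left_inverse (h.continuousOn.continuousAt hΩ) hexp hz0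
    (Filter.mem_of_superset hΩ h.exp_eq)

theorem iteratedDeriv_eq_nilssonEval {Ω : Set ℂ} {ℓ : ℂ → ℂ} {f : ℂ → ℂ}
    (h : Nilsson.IsLogDetermination Ω ℓ) (hG : ∀ s, ConvergesOn r (G s)) (hJ : G ∈ logDegreeLT J)
    (hf : ∀ z ∈ Ω ∩ Metric.ball 0 r, f z = nilssonEval E J G (ℓ z)) (i : ℕ) :
    ∀ z ∈ Ω ∩ Metric.ball 0 r,
      z ^ i * iteratedDeriv i f z = nilssonEval E J (fallingOp nilssonOp i G) (ℓ z) := by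
  have hU : IsOpen (Ω ∩ Metric.ball 0 r) := h.isOpen.inter Metric.isOpen_ball
  induction i with
  | zero =>
    intro z hz
    simpa [fallingOp] using hf z hz
  | succ i ih =>
    intro z hz
    obtain ⟨hGi, hJi⟩ := fallingOp_nilssonOp_mem hG hJ i
    have hexp := h.exp_eq z hz.1
    have hz0 : z ≠ 0 := by
      rw [← hexp]
      exact Complex.exp_ne_zero _
    have hzr : ‖Complex.exp (ℓ z)‖ < r := by
      rw [hexp]
      simpa using hz.2
    have hev := (hasDerivAt_nilssonEval (E := E) hGi hJi hzr).comp z (h.hasDerivAt hz.1)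
    have hpow := (hasDerivAt_pow i z).inv (pow_ne_zero i hz0)
    have heq : iteratedDeriv i f =ᶠ[𝓝 z]
        fun y => (y ^ i)⁻¹ * nilssonEval E J (fallingOp nilssonOp i G) (ℓ y) := by
      filter_upwards [hU.mem_nhds hz] with y hy
      have hy0 : y ≠ 0 := by
        rw [← h.exp_eq y hy.1]
        exact Complex.exp_ne_zero _
      rw [← ih y hy, inv_mul_cancel_left₀ (pow_ne_zero i hy0)]
    have hd := ((hpow.mul hev).congr_of_eventuallyEq heq).deriv
    have hsub : nilssonEval E J (fallingOp nilssonOp (i + 1) G) (ℓ z)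
        = nilssonEval E J (nilssonOp (fallingOp nilssonOp i G)) (ℓ z)
          - i * nilssonEval E J (fallingOp nilssonOp i G) (ℓ z) := by
      have hadd : fallingOp nilssonOp (i + 1) G = ∑ b : Bool, (bif b then
          nilssonOp (fallingOp nilssonOp i G) else (-(i : ℂ[X])) • fallingOp nilssonOp i G) := by
        rw [Fintype.sum_bool, cond_true, cond_false, neg_smul, Nat.cast_smul_eq_nsmul,
          ← sub_eq_add_neg]
        rfl
      rw [hadd, nilssonEval_sum _ _ hzr, Fintype.sum_bool, cond_true, cond_false,
        nilssonEval_smul _ hGi hzr]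
      · simp [sub_eq_add_neg]
      · rintro (_ | _) t
        · exact (hGi t).smul _
        · exact convergesOn_nilssonOp hGi t
    rw [iteratedDeriv_succ, hd, hsub]
    simp only [Function.comp_apply, Pi.inv_apply]
    rcases i with _ | i
    · simp
      field_simp
    · rw [Nat.add_sub_cancel]
      field_simp
      push_cast
      ring

end Evaluation

end ConvergentSeries

/-! ### Uniqueness of the coefficients -/

section Independence

variable {r : ℝ} {E : Finset ℚ} {J : ℕ} {G : ℚ × ℕ → PowerSeries ℂ}

/-- Analytic continuation along the half-plane `re w < log r`, where `z = exp w`: whatever the shape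
of `Ω` near the origin, one point of `Ω` suffices. -/
theorem nilssonEval_eq_zero_of_log {Ω : Set ℂ} {ℓ : ℂ → ℂ}
    (h : Nilsson.IsLogDetermination Ω ℓ) (hr : 0 < r) (hG : ∀ s, ConvergesOn r (G s))
    (hJ : G ∈ logDegreeLT J) (h0 : ∀ z ∈ Ω ∩ Metric.ball 0 r, nilssonEval E J G (ℓ z) = 0)
    {w : ℂ} (hw : ‖Complex.exp w‖ < r) : nilssonEval E J G w = 0 := by
  have hH : {w : ℂ | ‖Complex.exp w‖ < r} = {w : ℂ | w.re < Real.log r} := by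
    ext w
    simp [Complex.norm_exp, Real.lt_log_iff_exp_lt hr]
  have hopen : IsOpen {w : ℂ | ‖Complex.exp w‖ < r} :=
    isOpen_lt (by fun_prop) continuous_const
  have hpre : IsPreconnected {w : ℂ | ‖Complex.exp w‖ < r} := by
    rw [hH]
    exact (convex_halfSpace_re_lt _).isPreconnected
  have han : AnalyticOnNhd ℂ (nilssonEval E J G) {w : ℂ | ‖Complex.exp w‖ < r} :=
    DifferentiableOn.analyticOnNhd
      (fun w hw => (hasDerivAt_nilssonEval hG hJ hw).differentiableAt.differentiableWithinAt) hopen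
  obtain ⟨z₀, hz₀r, hz₀⟩ := mem_closure_iff.1 h.zero_mem_closure _ Metric.isOpen_ball
    (Metric.mem_ball_self hr)
  have hU : Ω ∩ Metric.ball 0 r ∈ 𝓝 z₀ :=
    (h.isOpen.inter Metric.isOpen_ball).mem_nhds ⟨hz₀, hz₀r⟩
  have hcont : Tendsto ℓ (𝓝[≠] z₀) (𝓝[≠] (ℓ z₀)) := by
    refine tendsto_nhdsWithin_iff.2 ⟨(h.hasDerivAt hz₀).continuousAt.tendsto.mono_left
      nhdsWithin_le_nhds, ?_⟩
    filter_upwards [self_mem_nhdsWithin, nhdsWithin_le_nhds hU] with z hz hzU heq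
    refine hz ?_
    rw [Set.mem_singleton_iff, ← h.exp_eq z hzU.1, Set.mem_singleton_iff.1 heq, h.exp_eq z₀ hz₀]
  have hfreq : ∃ᶠ w in 𝓝[≠] (ℓ z₀), nilssonEval E J G w = 0 :=
    hcont.frequently (Eventually.frequently
      (by filter_upwards [nhdsWithin_le_nhds hU] with z hz using h0 z hz))
  refine han.eqOn_zero_of_preconnected_of_frequently_eq_zero hpre ?_ hfreq hw
  simpa [h.exp_eq z₀ hz₀] using hz₀r

theorem tendsto_exp_neg_mul_pow_div_pow {δ : ℝ} {j k : ℕ} (h : 0 < δ ∨ δ = 0 ∧ j < k) :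
    Tendsto (fun t : ℝ => Real.exp (-δ * t) * (t ^ j / t ^ k)) atTop (𝓝 0) := by
  rcases h with h | ⟨rfl, h⟩
  · have h1 := tendsto_rpow_mul_exp_neg_mul_atTop_nhds_zero j δ h
    refine squeeze_zero' ?_ ?_ h1
    · filter_upwards [eventually_ge_atTop 0] with t ht
      positivity
    · filter_upwards [eventually_ge_atTop 1] with t ht
      rw [mul_comm, Real.rpow_natCast]
      have : t ^ j / t ^ k ≤ t ^ j :=
        div_le_self (by positivity) (one_le_pow₀ ht)
      gcongr
  · have h1 := tendsto_pow_neg_atTop (𝕜 := ℝ) (n := k - j) (by omega)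
    refine h1.congr' ?_
    filter_upwards [eventually_gt_atTop 0] with t ht
    rw [zpow_neg, zpow_natCast, pow_sub₀ t ht.ne' h.le]
    simp [div_eq_mul_inv]

/-- Linear independence of the `z^α log(z)^j` over convergent power series. As `z → 0⁺` a sum with
nonzero coefficients is asymptotic to its dominant term: least exponent of `z`, then highest power
of `log z`. Exponents `α` that are distinct modulo `ℤ` cannot compete. -/
theorem eq_zero_of_nilssonEval_eq_zero (hr : 0 < r)
    (hE : ∀ α ∈ E, ∀ β ∈ E, ∀ m : ℤ, α - β = m → α = β) (hG : ∀ s, ConvergesOn r (G s))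
    (h0 : ∀ w, ‖Complex.exp w‖ < r → nilssonEval E J G w = 0) {s : ℚ × ℕ} (hsE : s.1 ∈ E)
    (hsJ : s.2 < J) : G s = 0 := by
  classical
  by_contra hs
  let T := (E ×ˢ Finset.range J).filter fun s => G s ≠ 0
  have hT : T.Nonempty := ⟨s, by simp [T, hsE, hsJ, hs]⟩
  let m : ℚ × ℕ → ℕ := fun s => (G s).order.toNat
  let u : ℚ × ℕ → PowerSeries ℂ := fun s => (G s).divXPowOrder
  have hmu : ∀ s, G s = PowerSeries.X ^ m s * u s := fun s =>
    PowerSeries.X_pow_order_mul_divXPowOrder.symm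
  have hu : ∀ s, ConvergesOn r (u s) := fun s => ConvergesOn.of_X_pow_mul (hmu s ▸ hG s)
  let β : ℚ × ℕ → ℚ := fun s => s.1 + m s
  obtain ⟨s₀, hs₀, hmin⟩ := T.exists_min_image (fun s => toLex (β s, OrderDual.toDual s.2)) hT
  have hu₀ : PowerSeries.constantCoeff (u s₀) ≠ 0 := by
    rw [PowerSeries.constantCoeff_divXPowOrder]
    exact PowerSeries.coeff_order (Finset.mem_filter.1 hs₀).2
  have hmemT : ∀ s ∈ T, s.1 ∈ E := fun s hs =>
    (Finset.mem_product.1 (Finset.mem_filter.1 hs).1).1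
  have hdom : ∀ s ∈ T, s ≠ s₀ → 0 < β s - β s₀ ∨ β s - β s₀ = 0 ∧ s.2 < s₀.2 := by
    intro s hs hne
    rcases Prod.Lex.toLex_le_toLex.1 (hmin s hs) with hlt | ⟨heq, hle⟩
    · exact Or.inl (sub_pos.2 hlt)
    · replace heq : β s₀ = β s := heq
      refine Or.inr ⟨sub_eq_zero.2 heq.symm, lt_of_le_of_ne hle fun h2 => hne ?_⟩
      refine Prod.ext (hE _ (hmemT s hs) _ (hmemT s₀ hs₀) ((m s₀ : ℤ) - m s) ?_) h2
      simp only [β] at heq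
      push_cast
      linarith
  let x : ℝ → ℂ := fun t => ((-t : ℝ) : ℂ)
  let R : ℚ × ℕ → ℝ → ℂ := fun s t =>
    Complex.exp (((β s - β s₀ : ℚ) : ℂ) * x t) * (x t ^ s.2 / x t ^ s₀.2)
      * powerSum (u s) (Complex.exp (x t))
  have hexp : Tendsto (fun t => Complex.exp (x t)) atTop (𝓝 0) := by
    refine Complex.tendsto_exp_comap_re_atBot.comp (tendsto_comap_iff.2 ?_)
    have : (Complex.re ∘ x) = fun t => -t := by
      ext t
      simp [x]
    rw [this]
    exact tendsto_neg_atTop_atBot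
  have hpu : ∀ s, Tendsto (fun t => powerSum (u s) (Complex.exp (x t))) atTop
      (𝓝 (PowerSeries.constantCoeff (u s))) := fun s => by
    rw [← powerSum_at_zero]
    exact ((hu s).hasDerivAt (by simpa using hr)).continuousAt.tendsto.comp hexp
  have hR : ∀ s ∈ T, Tendsto (R s) atTop
      (𝓝 (if s = s₀ then PowerSeries.constantCoeff (u s₀) else 0)) := by
    intro s hs
    split_ifs with h
    · subst h
      refine (hpu s).congr' ?_
      filter_upwards [eventually_gt_atTop 0] with t ht
      have : x t ≠ 0 := by simp [x, ht.ne']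
      simp [R, this]
    · rw [← zero_mul (PowerSeries.constantCoeff (u s))]
      refine Tendsto.mul ?_ (hpu s)
      rw [tendsto_zero_iff_norm_tendsto_zero]
      have hd : (0 : ℝ) < ((β s - β s₀ : ℚ) : ℝ) ∨ ((β s - β s₀ : ℚ) : ℝ) = 0 ∧ s.2 < s₀.2 := by
        exact_mod_cast hdom s hs h
      refine (tendsto_exp_neg_mul_pow_div_pow hd).congr' ?_
      filter_upwards [eventually_ge_atTop 0] with t ht
      rw [norm_mul, norm_div, norm_pow, norm_pow, Complex.norm_exp, Complex.norm_real,
        Real.norm_eq_abs, abs_neg, abs_of_nonneg ht]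
      congr 2
      simp only [x]
      rw [← Complex.ofReal_ratCast, ← Complex.ofReal_mul, Complex.ofReal_re]
      ring
  have hsum : ∀ᶠ t in atTop, ∑ s ∈ T, R s t = 0 := by
    have hsmall : ∀ᶠ t in atTop, ‖Complex.exp (x t)‖ < r :=
      (tendsto_zero_iff_norm_tendsto_zero.1 hexp).eventually_lt_const hr
    filter_upwards [hsmall, eventually_gt_atTop 0] with t ht ht0
    have hev := h0 (x t) ht
    have hT' : nilssonEval E J G (x t) = ∑ s ∈ T,
        Complex.exp ((s.1 : ℂ) * x t) * x t ^ s.2 * powerSum (G s) (Complex.exp (x t)) := by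
      rw [nilssonEval, ← Finset.sum_product', Finset.sum_filter_of_ne]
      intro s _ hne h
      exact hne (by rw [h, powerSum_zero, mul_zero])
    have hRt : ∀ s, R s t = Complex.exp (-(β s₀ : ℂ) * x t) / x t ^ s₀.2 *
        (Complex.exp ((s.1 : ℂ) * x t) * x t ^ s.2 * powerSum (G s) (Complex.exp (x t))) := by
      intro s
      have hps : powerSum (G s) (Complex.exp (x t))
          = Complex.exp ((m s : ℂ) * x t) * powerSum (u s) (Complex.exp (x t)) := by
        have h1 := (hu s).powerSum_smul (Polynomial.X ^ m s) ht
        rw [polynomial_smul_eq, Polynomial.coe_pow, Polynomial.coe_X, ← hmu] at h1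
        rw [h1, Polynomial.eval_pow, Polynomial.eval_X, ← Complex.exp_nat_mul]
      have hβ : Complex.exp (((β s - β s₀ : ℚ) : ℂ) * x t) = Complex.exp (-(β s₀ : ℂ) * x t)
          * Complex.exp ((s.1 : ℂ) * x t) * Complex.exp ((m s : ℂ) * x t) := by
        rw [← Complex.exp_add, ← Complex.exp_add]
        congr 1
        simp only [β]
        push_cast
        ring
      simp only [R]
      rw [hβ, hps]
      ring
    simp only [hRt]
    rw [← Finset.mul_sum, ← hT', hev, mul_zero]
  have hlim := tendsto_finsetSum T hR
  rw [Finset.sum_ite_eq' T s₀, if_pos hs₀] at hlim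
  exact hu₀ (tendsto_nhds_unique (hlim.congr' hsum) tendsto_const_nhds)

end Independence

/-! ### Holonomic Nilsson–Gevrey series -/

namespace Nilsson

local notation "ℚbar" => AlgebraicClosure ℚ

variable {ι : ℚbar →+* ℂ}

theorem seriesSum_eq_powerSum (ι : ℚbar →+* ℂ) (F : PowerSeries ℚbar) (z : ℂ) :
    seriesSum ι F z = powerSum (PowerSeries.map ι F) z := by
  simp [seriesSum, powerSum]

theorem IsArithmeticGevrey.exists_convergesOn {F : PowerSeries ℚbar} (hF : IsArithmeticGevrey ι F) :
    ∃ r > 0, ConvergesOn r (PowerSeries.map ι F) := by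
  obtain ⟨C, hC, hFC, -⟩ := hF
  refine ⟨C⁻¹, inv_pos.2 hC, fun z hz => ?_⟩
  have hlt : C * ‖z‖ < 1 := by
    rwa [← lt_inv_mul_iff₀ hC, mul_one]
  refine Summable.of_norm_bounded
    ((summable_geometric_of_lt_one (by positivity) hlt).mul_left C) fun n => ?_
  rw [norm_mul, norm_pow, PowerSeries.coeff_map, mul_pow, ← mul_assoc, ← pow_succ']
  exact mul_le_mul_of_nonneg_right (hFC 1 n) (by positivity)

theorem exists_common_radius {κ : Type*} (S : Finset κ) {F : κ → PowerSeries ℚbar}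
    (hF : ∀ s ∈ S, IsArithmeticGevrey ι (F s)) :
    ∃ r > 0, ∀ s ∈ S, ConvergesOn r (PowerSeries.map ι (F s)) := by
  classical
  induction S using Finset.induction_on with
  | empty => exact ⟨1, one_pos, by simp⟩
  | insert a S ha ih =>
    obtain ⟨r, hr, h⟩ := ih fun s hs => hF s (Finset.mem_insert_of_mem hs)
    obtain ⟨r', hr', h'⟩ := (hF a (Finset.mem_insert_self a S)).exists_convergesOn
    refine ⟨min r r', lt_min hr hr', fun s hs => ?_⟩
    rcases Finset.mem_insert.1 hs with rfl | hs
    · exact h'.mono (min_le_right _ _)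
    · exact (h s hs).mono (min_le_left _ _)

/-- A holonomic `ℂ`-linear combination of series satisfying the arithmetic growth conditions is a
combination, with the same coefficients, of `G`-functions. -/
theorem exists_gFunction_decomposition {κ : Type*} (S : Finset κ) (c : κ → ℂ)
    {F : κ → PowerSeries ℚbar} (hF : ∀ s ∈ S, IsArithmeticGevrey ι (F s))
    (h : IsHolonomicSeries (∑ s ∈ S, c s • PowerSeries.map ι (F s))) :
    ∃ H : κ → PowerSeries ℚbar, (∀ s ∈ S, IsGFunction ι (H s)) ∧
      ∑ s ∈ S, c s • PowerSeries.map ι (F s) = ∑ s ∈ S, c s • PowerSeries.map ι (H s) := by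
  classical
  let _ := ι.toAlgebra
  rw [← Finset.sum_coe_sort S fun s => c s • PowerSeries.map ι (F s)] at h ⊢
  obtain ⟨P, hP, hc⟩ := exists_holonomic_decomposition (fun s : S => F s) (fun s : S => c s) h
  let H : κ → PowerSeries ℚbar := fun s => if hs : s ∈ S then ∑ k : S, P ⟨s, hs⟩ k • F k else 0
  have hH : ∀ s : S, H s = ∑ k : S, P s k • F k := fun s => dif_pos s.2
  refine ⟨H, fun s hs => ?_, ?_⟩
  · rw [hH ⟨s, hs⟩]
    exact ⟨hP _, IsArithmeticGevrey.sum _ fun k _ => (hF k k.2).smul _⟩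
  · rw [← Finset.sum_coe_sort S fun s => c s • PowerSeries.map ι (H s)]
    have hc' : ∀ k : S, c k = ∑ l : S, c l * ι (P l k) := hc
    ext n
    simp only [hH, map_sum, PowerSeries.coeff_smul, PowerSeries.coeff_map, smul_eq_mul, map_mul]
    simp_rw [Finset.mul_sum]
    rw [Finset.sum_comm]
    refine Finset.sum_congr rfl fun k _ => ?_
    conv_lhs => rw [hc' k]
    rw [Finset.sum_mul]
    exact Finset.sum_congr rfl fun l _ => by ring

/-- The family of coefficients of the formal sum `∑ z^α log(z)^j cₛ Fₛ` over `s ∈ S`, where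
`(α, j) = a s`. -/
noncomputable def formalSum {κ : Type*} (ι : ℚbar →+* ℂ) (S : Finset κ) (a : κ → ℚ × ℕ) (c : κ → ℂ)
    (F : κ → PowerSeries ℚbar) : ℚ × ℕ → PowerSeries ℂ :=
  ∑ s ∈ S, Pi.single (a s) (c s • PowerSeries.map ι (F s))

section FormalSum

variable {κ : Type*} {S : Finset κ} {a : κ → ℚ × ℕ} {c : κ → ℂ} {F : κ → PowerSeries ℚbar}
  {E : Finset ℚ} {J : ℕ} {r : ℝ}

theorem formalSum_apply (t : ℚ × ℕ) : formalSum ι S a c F t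
    = ∑ s ∈ S.filter fun s => a s = t, c s • PowerSeries.map ι (F s) := by
  classical
  rw [formalSum, Finset.sum_apply, Finset.sum_filter]
  refine Finset.sum_congr rfl fun s _ => ?_
  rw [Pi.single_apply]
  simp only [eq_comm]

theorem convergesOn_formalSum (hF : ∀ s ∈ S, ConvergesOn r (PowerSeries.map ι (F s)))
    (t : ℚ × ℕ) : ConvergesOn r (formalSum ι S a c F t) := by
  rw [formalSum_apply]
  refine ConvergesOn.sum _ fun s hs => ?_
  rw [← C_smul_eq]
  exact (hF s (Finset.mem_filter.1 hs).1).smul _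

theorem formalSum_mem_logDegreeLT (ha : ∀ s ∈ S, (a s).2 < J) :
    formalSum ι S a c F ∈ logDegreeLT J := by
  intro t ht
  rw [formalSum_apply, Finset.filter_false_of_mem, Finset.sum_empty]
  rintro s hs rfl
  exact absurd (ha s hs) (not_lt.2 ht)

theorem nilssonEval_formalSum (haE : ∀ s ∈ S, (a s).1 ∈ E) (haJ : ∀ s ∈ S, (a s).2 < J)
    (hF : ∀ s ∈ S, ConvergesOn r (PowerSeries.map ι (F s))) {w : ℂ} (hw : ‖Complex.exp w‖ < r) :
    nilssonEval E J (formalSum ι S a c F) w = ∑ s ∈ S, c s * Complex.exp (((a s).1 : ℂ) * w)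
      * w ^ (a s).2 * seriesSum ι (F s) (Complex.exp w) := by
  classical
  have hC : ∀ s ∈ S, ConvergesOn r (c s • PowerSeries.map ι (F s)) := fun s hs => by
    rw [← C_smul_eq]
    exact (hF s hs).smul _
  rw [nilssonEval, ← Finset.sum_product', ← Finset.sum_fiberwise_of_maps_to (t := E ×ˢ Finset.range J)
    (g := a) fun s hs => Finset.mem_product.2 ⟨haE s hs, Finset.mem_range.2 (haJ s hs)⟩]
  refine Finset.sum_congr rfl fun t _ => ?_
  rw [formalSum_apply, ConvergesOn.powerSum_sum _ (fun s hs => hC s (Finset.mem_filter.1 hs).1) hw,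
    Finset.mul_sum]
  refine Finset.sum_congr rfl fun s hst => ?_
  obtain ⟨hs, rfl⟩ := Finset.mem_filter.1 hst
  rw [← C_smul_eq, (hF s hs).powerSum_smul _ hw, Polynomial.eval_C, seriesSum_eq_powerSum]
  ring

end FormalSum

section Main

variable {Ω : Set ℂ} {ℓ : ℂ → ℂ} {f : ℂ → ℂ}

theorem eventually_nhdsWithin_zero_iff {p : ℂ → Prop} :
    (∀ᶠ z in 𝓝[Ω] 0, p z) ↔ ∃ r > 0, ∀ z ∈ Ω ∩ Metric.ball 0 r, p z := by
  rw [Filter.Eventually, Metric.mem_nhdsWithin_iff]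
  simp only [Set.inter_comm Ω]
  rfl

theorem isHolonomic_of_isDFinite (hℓ : IsLogDetermination Ω ℓ) {E : Finset ℚ} {J : ℕ} {r : ℝ}
    {G : ℚ × ℕ → PowerSeries ℂ} (hr : 0 < r) (hG : ∀ s, ConvergesOn r (G s))
    (hJ : G ∈ logDegreeLT J) (hfin : IsDFinite ℂ nilssonOp G)
    (hf : ∀ z ∈ Ω ∩ Metric.ball 0 r, f z = nilssonEval E J G (ℓ z)) : IsHolonomic Ω f := by
  have hU : IsOpen (Ω ∩ Metric.ball 0 r) := hℓ.isOpen.inter Metric.isOpen_ball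
  have hexp : ∀ z ∈ Ω ∩ Metric.ball 0 r, ‖Complex.exp (ℓ z)‖ < r := fun z hz => by
    rw [hℓ.exp_eq z hz.1]
    simpa using hz.2
  obtain ⟨N, p, ⟨i, hi, hpi⟩, heq⟩ := hfin.exists_equation isEulerOperator_nilssonOp
  refine ⟨r, hr, DifferentiableOn.analyticOnNhd (fun z hz => ?_) hU, N,
    fun i => p i * Polynomial.X ^ i,
    ⟨i, hi, mul_ne_zero hpi (pow_ne_zero _ Polynomial.X_ne_zero)⟩, fun z hz => ?_⟩
  · have hd := (hasDerivAt_nilssonEval (E := E) hG hJ (hexp z hz)).comp z (hℓ.hasDerivAt hz.1)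
    have hev : f =ᶠ[𝓝 z] nilssonEval E J G ∘ ℓ := by
      filter_upwards [hU.mem_nhds hz] with y hy using hf y hy
    exact (hd.congr_of_eventuallyEq hev).differentiableAt.differentiableWithinAt
  · have hT := fun i => (fallingOp_nilssonOp_mem hG hJ i).1
    have h1 := nilssonEval_sum (E := E) (J := J) (Finset.range (N + 1))
      (G := fun i => p i • fallingOp nilssonOp i G) (fun i t => (hT i t).smul _) (hexp z hz)
    rw [heq] at h1
    have h2 : nilssonEval E J 0 (ℓ z) = 0 := by simp [nilssonEval]
    rw [h2] at h1
    rw [h1]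
    refine Finset.sum_congr rfl fun j _ => ?_
    rw [nilssonEval_smul _ (hT j) (hexp z hz), hℓ.exp_eq z hz.1,
      ← iteratedDeriv_eq_nilssonEval hℓ hG hJ hf j z hz]
    simp only [Polynomial.eval_mul, Polynomial.eval_pow, Polynomial.eval_X]
    ring

theorem isDFinite_of_isHolonomic (hℓ : IsLogDetermination Ω ℓ) {E : Finset ℚ} {J : ℕ} {r : ℝ}
    {G : ℚ × ℕ → PowerSeries ℂ} (hr : 0 < r) (hG : ∀ s, ConvergesOn r (G s))
    (hJ : G ∈ logDegreeLT J) (hGE : ∀ s : ℚ × ℕ, s.1 ∉ E → G s = 0)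
    (hE : ∀ α ∈ E, ∀ β ∈ E, ∀ m : ℤ, α - β = m → α = β)
    (hf : ∀ z ∈ Ω ∩ Metric.ball 0 r, f z = nilssonEval E J G (ℓ z)) (hol : IsHolonomic Ω f) :
    IsDFinite ℂ nilssonOp G := by
  obtain ⟨r', hr', -, N, p, ⟨i, hi, hpi⟩, heq⟩ := hol
  -- the equation of `f`, multiplied by `z ^ N`, holds formally
  let p' : ℕ → Polynomial ℂ := fun i => p i * Polynomial.X ^ (N - i)
  have hT := fun i => fallingOp_nilssonOp_mem hG hJ i
  have hT' : ∀ i t, ConvergesOn r ((p' i • fallingOp nilssonOp i G) t) :=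
    fun i t => ((hT i).1 t).smul _
  let Q : ℚ × ℕ → PowerSeries ℂ :=
    ∑ i ∈ Finset.range (N + 1), p' i • fallingOp nilssonOp i G
  have hQJ : Q ∈ logDegreeLT J := Submodule.sum_mem _ fun i _ => Submodule.smul_mem _ _ (hT i).2
  have hQ : ∀ s, ConvergesOn r (Q s) := fun s => by
    simp only [Q, Finset.sum_apply]
    exact ConvergesOn.sum _ fun i _ => hT' i s
  have hQE : ∀ s : ℚ × ℕ, s.1 ∉ E → Q s = 0 := by
    have hTE : ∀ i, ∀ s : ℚ × ℕ, s.1 ∉ E → fallingOp nilssonOp i G s = 0 := by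
      intro i
      induction i with
      | zero => exact hGE
      | succ i ih =>
        intro s hs
        rw [fallingOp, Pi.sub_apply, Pi.smul_apply, nilssonOp_apply, ih s hs, ih (s.1, s.2 + 1) hs]
        simp
    intro s hs
    simp only [Q, Finset.sum_apply, Pi.smul_apply, hTE _ s hs, smul_zero, Finset.sum_const_zero]
  have hmin : 0 < min r r' := lt_min hr hr'
  have hzero : ∀ w, ‖Complex.exp w‖ < min r r' → nilssonEval E J Q w = 0 := fun w hw => by
    refine nilssonEval_eq_zero_of_log hℓ hmin (fun s => (hQ s).mono (min_le_left _ _)) hQJ ?_ hw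
    intro z hz
    have hzr : ‖z‖ < min r r' := by simpa using hz.2
    have hz1 : z ∈ Ω ∩ Metric.ball 0 r := ⟨hz.1, by simpa using hzr.trans_le (min_le_left _ _)⟩
    have hz2 : z ∈ Ω ∩ Metric.ball 0 r' := ⟨hz.1, by simpa using hzr.trans_le (min_le_right _ _)⟩
    have hexp : ‖Complex.exp (ℓ z)‖ < r := by
      rw [hℓ.exp_eq z hz.1]
      exact hzr.trans_le (min_le_left _ _)
    simp only [Q]
    rw [nilssonEval_sum _ hT' hexp, ← mul_zero (z ^ N), ← heq z hz2, Finset.mul_sum]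
    refine Finset.sum_congr rfl fun j hj => ?_
    have hj' : j ≤ N := Nat.lt_succ_iff.1 (Finset.mem_range.1 hj)
    rw [nilssonEval_smul _ (hT j).1 hexp, hℓ.exp_eq z hz.1,
      ← iteratedDeriv_eq_nilssonEval hℓ hG hJ hf j z hz1]
    simp only [p', Polynomial.eval_mul, Polynomial.eval_pow, Polynomial.eval_X]
    rw [← Nat.sub_add_cancel hj', pow_add, Nat.sub_add_cancel hj']
    ring
  have hQ0 : Q = 0 := by
    ext1 s
    by_cases hs1 : s.1 ∈ E
    · by_cases hs2 : s.2 < J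
      · exact eq_zero_of_nilssonEval_eq_zero hmin hE (fun s => (hQ s).mono (min_le_left _ _))
          hzero hs1 hs2
      · exact hQJ s (not_lt.1 hs2)
    · exact hQE s hs1
  exact IsDFinite.of_equation isEulerOperator_nilssonOp
    ⟨i, hi, mul_ne_zero hpi (pow_ne_zero _ Polynomial.X_ne_zero)⟩ hQ0

theorem isHolonomic_of_isGFunction (hℓ : IsLogDetermination Ω ℓ) {S : Finset (ℚ × ℕ × ℕ)}
    {c : ℚ × ℕ × ℕ → ℂ} {F : ℚ × ℕ × ℕ → PowerSeries ℚbar} (hF : ∀ s ∈ S, IsGFunction ι (F s))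
    (hf : ∀ᶠ z in 𝓝[Ω] 0, f z = nilssonSum ι ℓ S c F z) : IsHolonomic Ω f := by
  classical
  obtain ⟨r₁, hr₁, hconv⟩ := exists_common_radius S fun s hs => (hF s hs).2
  obtain ⟨r₂, hr₂, hf⟩ := eventually_nhdsWithin_zero_iff.1 hf
  let a : ℚ × ℕ × ℕ → ℚ × ℕ := fun s => (s.1, s.2.1)
  have haJ : ∀ s ∈ S, (a s).2 < S.sup (fun s => (a s).2) + 1 := fun s hs =>
    Nat.lt_succ_of_le (Finset.le_sup (f := fun s => (a s).2) hs)
  have haE : ∀ s ∈ S, (a s).1 ∈ S.image fun s => (a s).1 := fun s hs =>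
    Finset.mem_image_of_mem _ hs
  have hconv' : ∀ s ∈ S, ConvergesOn (min r₁ r₂) (PowerSeries.map ι (F s)) := fun s hs =>
    (hconv s hs).mono (min_le_left _ _)
  refine isHolonomic_of_isDFinite hℓ (E := S.image fun s => (a s).1) (lt_min hr₁ hr₂)
    (G := formalSum ι S a c F) (convergesOn_formalSum hconv') (formalSum_mem_logDegreeLT haJ) ?_
    fun z hz => ?_
  · refine IsDFinite.sum _ fun s hs => isDFinite_single _ ?_
    rw [← C_smul_eq]
    exact (isHolonomicSeries_iff.1 (isHolonomicSeries_map ι (hF s hs).1)).smul _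
  · have hzr : ‖z‖ < min r₁ r₂ := by simpa using hz.2
    rw [nilssonEval_formalSum haE haJ hconv'
      (by rwa [hℓ.exp_eq z hz.1]), hℓ.exp_eq z hz.1,
      hf z ⟨hz.1, by simpa using hzr.trans_le (min_le_right _ _)⟩]
    rfl

/-- Each exponent is replaced by a representative of its class modulo `ℤ`, the difference being
absorbed in the power series. The coefficients of the resulting formal sum are then well defined,
hence holonomic, and are decomposed one by one. -/
theorem exists_gFunction_of_isHolonomic (hℓ : IsLogDetermination Ω ℓ) (hf : IsNGA ι Ω ℓ f)
    (hol : IsHolonomic Ω f) : ∃ (S : Finset (ℚ × ℕ × ℕ)) (c : ℚ × ℕ × ℕ → ℂ)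
      (F : ℚ × ℕ × ℕ → PowerSeries ℚbar), (∀ s ∈ S, IsGFunction ι (F s)) ∧
        ∀ᶠ z in 𝓝[Ω] 0, f z = nilssonSum ι ℓ S c F z := by
  classical
  obtain ⟨S, c, F, hF, hf⟩ := hf
  -- a shift making all exponents `⌊α⌋ + M` of the absorbed monomials nonnegative
  obtain ⟨M, hM⟩ : ∃ M : ℕ, ∀ s ∈ S, 0 ≤ ⌊s.1⌋ + (M : ℤ) := by
    refine ⟨S.sup fun s => ⌊s.1⌋.natAbs, fun s hs => ?_⟩
    have h := Finset.le_sup (f := fun s : ℚ × ℕ × ℕ => ⌊s.1⌋.natAbs) hs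
    omega
  let n : ℚ × ℕ × ℕ → ℕ := fun s => (⌊s.1⌋ + (M : ℤ)).toNat
  let a : ℚ × ℕ × ℕ → ℚ × ℕ := fun s => (Int.fract s.1 - M, s.2.1)
  let F' : ℚ × ℕ × ℕ → PowerSeries ℚbar := fun s => PowerSeries.X ^ n s * F s
  have hF' : ∀ s ∈ S, IsArithmeticGevrey ι (F' s) := fun s hs => (hF s hs).X_pow_mul _
  let E := S.image fun s => (a s).1
  let J := S.sup (fun s => (a s).2) + 1
  have haE : ∀ s ∈ S, (a s).1 ∈ E := fun s hs => Finset.mem_image_of_mem _ hs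
  have haJ : ∀ s ∈ S, (a s).2 < J := fun s hs =>
    Nat.lt_succ_of_le (Finset.le_sup (f := fun s => (a s).2) hs)
  have hE : ∀ α ∈ E, ∀ β ∈ E, ∀ m : ℤ, α - β = m → α = β := by
    intro α hα β hβ m hm
    obtain ⟨s, -, rfl⟩ := Finset.mem_image.1 hα
    obtain ⟨t, -, rfl⟩ := Finset.mem_image.1 hβ
    simp only [a, sub_sub_sub_cancel_right, sub_left_inj] at hm ⊢
    have h := Int.fract_eq_fract.2 ⟨m, hm⟩
    rwa [Int.fract_fract, Int.fract_fract] at h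
  obtain ⟨r₁, hr₁, hconv₁⟩ := exists_common_radius S hF
  obtain ⟨r₂, hr₂, hconv₂⟩ := exists_common_radius S hF'
  obtain ⟨r₃, hr₃, hf⟩ := eventually_nhdsWithin_zero_iff.1 hf
  have hr : 0 < min (min r₁ r₂) r₃ := lt_min (lt_min hr₁ hr₂) hr₃
  set r := min (min r₁ r₂) r₃
  have hrr₁ : r ≤ r₁ := (min_le_left _ _).trans (min_le_left _ _)
  have hconv : ∀ s ∈ S, ConvergesOn r (PowerSeries.map ι (F' s)) := fun s hs =>
    (hconv₂ s hs).mono ((min_le_left _ _).trans (min_le_right _ _))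
  let G := formalSum ι S a c F'
  have hG : ∀ t, ConvergesOn r (G t) := convergesOn_formalSum hconv
  have hJ : G ∈ logDegreeLT J := formalSum_mem_logDegreeLT haJ
  have hGE : ∀ t : ℚ × ℕ, t.1 ∉ E → G t = 0 := by
    intro t ht
    simp only [G]
    rw [formalSum_apply, Finset.filter_false_of_mem, Finset.sum_empty]
    rintro s hs rfl
    exact ht (haE s hs)
  have hfG : ∀ z ∈ Ω ∩ Metric.ball 0 r, f z = nilssonEval E J G (ℓ z) := by
    intro z hz
    have hzr : ‖z‖ < r := by simpa using hz.2
    have hexp := hℓ.exp_eq z hz.1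
    rw [nilssonEval_formalSum haE haJ hconv (by rwa [hexp]), hexp,
      hf z ⟨hz.1, by simpa using hzr.trans_le (min_le_right _ _)⟩, nilssonSum]
    refine Finset.sum_congr rfl fun s hs => ?_
    have h1 : seriesSum ι (F' s) z = z ^ n s * seriesSum ι (F s) z := by
      have h := ((hconv₁ s hs).mono hrr₁).powerSum_smul (Polynomial.X ^ n s) hzr
      rw [polynomial_smul_eq, Polynomial.coe_pow, Polynomial.coe_X, Polynomial.eval_pow,
        Polynomial.eval_X] at h
      rw [seriesSum_eq_powerSum, seriesSum_eq_powerSum, ← h, map_mul, map_pow, PowerSeries.map_X]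
    have h2 : Complex.exp ((s.1 : ℂ) * ℓ z)
        = Complex.exp (((a s).1 : ℂ) * ℓ z) * z ^ n s := by
      have hn : (n s : ℚ) = ⌊s.1⌋ + M := by
        have h := Int.toNat_of_nonneg (hM s hs)
        exact_mod_cast congrArg (Int.cast : ℤ → ℚ) h
      have hs1 : s.1 = (a s).1 + n s := by
        rw [hn]
        simp only [a]
        linarith [Int.floor_add_fract s.1]
      conv_lhs => rw [hs1]
      conv_rhs => rw [← hexp]
      rw [← Complex.exp_nat_mul, hexp, ← Complex.exp_add]
      congr 1
      push_cast
      ring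
    rw [h1, h2]
    ring
  have hcoeff : ∀ t, IsHolonomicSeries (G t) := fun t => isHolonomicSeries_iff.2
    ((isDFinite_of_isHolonomic hℓ hr hG hJ hGE hE hfG hol).nilsson_coeff hGE hJ t)
  have hdec : ∀ t, ∃ H : ℚ × ℕ × ℕ → PowerSeries ℚbar,
      (∀ s ∈ S.filter fun s => a s = t, IsGFunction ι (H s)) ∧
        G t = ∑ s ∈ S.filter fun s => a s = t, c s • PowerSeries.map ι (H s) := by
    intro t
    have h := hcoeff t
    simp only [G, formalSum_apply] at h ⊢
    exact exists_gFunction_decomposition _ c (fun s hs => hF' s (Finset.mem_filter.1 hs).1) h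
  choose H hH hGH using hdec
  let H' : ℚ × ℕ × ℕ → PowerSeries ℚbar := fun s => H (a s) s
  have hH' : ∀ s ∈ S, IsGFunction ι (H' s) := fun s hs =>
    hH (a s) s (Finset.mem_filter.2 ⟨hs, rfl⟩)
  have hGH' : G = formalSum ι S a c H' := by
    ext1 t
    rw [hGH, formalSum_apply]
    refine Finset.sum_congr rfl fun s hs => ?_
    rw [← (Finset.mem_filter.1 hs).2]
  obtain ⟨r₄, hr₄, hconv₄⟩ := exists_common_radius S fun s hs => (hH' s hs).2
  -- the third index, free in the target, keeps track of the original triple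
  let e : ℚ × ℕ × ℕ → ℚ × ℕ × ℕ := fun s => ((a s).1, (a s).2, Encodable.encode s)
  have he : Function.Injective e := fun s t h =>
    Encodable.encode_injective (congrArg (fun x => x.2.2) h)
  have hinv : ∀ s, Function.invFun e (e s) = s := Function.leftInverse_invFun he
  refine ⟨S.image e, c ∘ Function.invFun e, H' ∘ Function.invFun e, ?_,
    eventually_nhdsWithin_zero_iff.2 ⟨min r r₄, lt_min hr hr₄, fun z hz => ?_⟩⟩
  · intro s hs
    obtain ⟨t, ht, rfl⟩ := Finset.mem_image.1 hs
    simpa [hinv] using hH' t ht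
  · have hzr : ‖z‖ < min r r₄ := by simpa using hz.2
    have hexp := hℓ.exp_eq z hz.1
    rw [hfG z ⟨hz.1, by simpa using hzr.trans_le (min_le_left _ _)⟩, hGH',
      nilssonEval_formalSum haE haJ (fun s hs => (hconv₄ s hs).mono (min_le_right r r₄))
        (by rwa [hexp]), hexp, nilssonSum, Finset.sum_image fun s _ t _ h => he h]
    simp only [Function.comp_apply, hinv]
    rfl

end Main

end Nilsson

theorem proposition1 (ι : AlgebraicClosure ℚ →+* ℂ) (Ω : Set ℂ) (ℓ : ℂ → ℂ)
    (hℓ : Nilsson.IsLogDetermination Ω ℓ) (f : ℂ → ℂ) :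
    (Nilsson.IsNGA ι Ω ℓ f ∧ Nilsson.IsHolonomic Ω f) ↔
      ∃ (S : Finset (ℚ × ℕ × ℕ)) (c : ℚ × ℕ × ℕ → ℂ)
        (F : ℚ × ℕ × ℕ → PowerSeries (AlgebraicClosure ℚ)),
        (∀ s ∈ S, Nilsson.IsGFunction ι (F s)) ∧
          ∀ᶠ z in 𝓝[Ω] 0, f z = Nilsson.nilssonSum ι ℓ S c F z := by
  constructor
  · rintro ⟨hf, hol⟩
    exact Nilsson.exists_gFunction_of_isHolonomic hℓ hf hol
  · rintro ⟨S, c, F, hF, hf⟩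
    exact ⟨⟨S, c, F, fun s hs => (hF s hs).2, hf⟩, Nilsson.isHolonomic_of_isGFunction hℓ hF hf⟩
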